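/- Let $h\ge 1$ and let $\Pi=\langle x_1,\dots,x_h \mid x_1^2x_2^2\cdots x_h^2=1\rangle$, which is the fundamental group of the closed non-orientable surface obtained as the connected sum of $h$ copies of $\mathbb{RP}^2$. Let $G$ be a complex reductive Lie group (not necessarily connected), that is, a complex Lie group isomorphic to a Zariski closed subgroup of some $GL_n(\mathbb C)$ with trivial unipotent radical. Let $\mathfrak g$ be its Lie algebra and $\mathrm{Ad}$ its adjoint representation. For a homomorphism $\phi\colon\Pi\to G$ let $\mathfrak g_{\mathrm{Ad}\circ\phi}$ be the vector space $\mathfrak g$ on which $\Pi$ acts through $\mathrm{Ad}\circ\phi$. Then for every $\phi\in\mathrm{Hom}(\Pi,G)$ the group cohomology satisfies $$H^0(\Pi,\mathfrak g_{\mathrm{Ad}\circ\phi})=\mathfrak g^{\Pi}=\bigcap_{i=1}^h\ker(\mathrm{Ad}_{\phi(x_i)}-1),$$ where $H^0$ is identified with the subspace $\mathfrak g^\Pi$ of $\Pi$-invariant vectors, and, if $h\ge 2$, there is an isomorphism of complex vector spaces $$H^2(\Pi,\mathfrak g_{\mathrm{Ad}\circ\phi})\cong\bigcap_{i=1}^h\ker(\mathrm{Ad}_{\phi(x_i)}+1).$$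 -/

import Mathlib

open scoped Manifold ContDiff

noncomputable section

/-! ### The adjoint representation of a complex Lie group -/

section Adjoint

variable (E : Type*) [NormedAddCommGroup E] [NormedSpace ℂ E]
  (G : Type*) [TopologicalSpace G] [ChartedSpace E G] [Group G]

/-- The differential at the identity of the conjugation `x ↦ g * x * g⁻¹`, as an endomorphism of
the Lie algebra (the tangent space of `G` at the identity). The tangent space at `g * 1 * g⁻¹`,
where the differential takes its values, is the tangent space at the identity. -/
def adLinear (g : G) : GroupLieAlgebra 𝓘(ℂ, E) G →ₗ[ℂ] GroupLieAlgebra 𝓘(ℂ, E) G where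
  toFun v := mfderiv 𝓘(ℂ, E) 𝓘(ℂ, E) (fun x : G => g * x * g⁻¹) 1 v
  map_add' v w := (mfderiv 𝓘(ℂ, E) 𝓘(ℂ, E) (fun x : G => g * x * g⁻¹) 1).map_add v w
  map_smul' c v := (mfderiv 𝓘(ℂ, E) 𝓘(ℂ, E) (fun x : G => g * x * g⁻¹) 1).map_smul c v

theorem adLinear_one : adLinear E G 1 = 1 := by
  have h : (fun x : G => 1 * x * 1⁻¹) = id := by ext x; simp
  ext v
  change mfderiv 𝓘(ℂ, E) 𝓘(ℂ, E) (fun x : G => 1 * x * 1⁻¹) 1 v = v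
  rw [h, mfderiv_id]
  rfl

theorem adLinear_mul [LieGroup 𝓘(ℂ, E) ω G] (a b : G) :
    adLinear E G (a * b) = adLinear E G a * adLinear E G b := by
  have hd : ∀ (g y : G), MDifferentiableAt 𝓘(ℂ, E) 𝓘(ℂ, E) (fun x : G => g * x * g⁻¹) y := by
    intro g y
    have hc : ContMDiff 𝓘(ℂ, E) 𝓘(ℂ, E) ω (fun x : G => g * x * g⁻¹) :=
      (contMDiff_mul_right (a := g⁻¹)).comp (contMDiff_mul_left (a := g))
    exact (hc y).mdifferentiableAt (by simp)
  have h : (fun x : G => a * b * x * (a * b)⁻¹)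
      = (fun x : G => a * x * a⁻¹) ∘ (fun x : G => b * x * b⁻¹) := by
    ext x; simp [mul_assoc]
  have h1 : b * 1 * b⁻¹ = (1 : G) := by simp
  ext v
  change mfderiv 𝓘(ℂ, E) 𝓘(ℂ, E) (fun x : G => a * b * x * (a * b)⁻¹) 1 v
    = mfderiv 𝓘(ℂ, E) 𝓘(ℂ, E) (fun x : G => a * x * a⁻¹) 1
      (mfderiv 𝓘(ℂ, E) 𝓘(ℂ, E) (fun x : G => b * x * b⁻¹) 1 v)
  rw [h, mfderiv_comp 1 (hd a _) (hd b _)]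
  change mfderiv 𝓘(ℂ, E) 𝓘(ℂ, E) (fun x : G => a * x * a⁻¹) (b * 1 * b⁻¹)
      (mfderiv 𝓘(ℂ, E) 𝓘(ℂ, E) (fun x : G => b * x * b⁻¹) 1 v) = _
  generalize mfderiv 𝓘(ℂ, E) 𝓘(ℂ, E) (fun x : G => b * x * b⁻¹) 1 v = w
  revert w
  rw [h1]
  intro w
  rfl

/-- The adjoint representation `Ad` of a complex Lie group on its Lie algebra. -/
def adjointRep [LieGroup 𝓘(ℂ, E) ω G] : Representation ℂ G (GroupLieAlgebra 𝓘(ℂ, E) G) where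
  toFun := adLinear E G
  map_one' := adLinear_one E G
  map_mul' := adLinear_mul E G

end Adjoint

/-! ### Complex reductive groups -/

/-- A subgroup of `GL_n(ℂ)` is Zariski closed if it is the zero locus in `GL_n(ℂ)` of a set of
polynomials in the matrix entries. -/
def IsZariskiClosed {n : ℕ} (H : Subgroup (GL (Fin n) ℂ)) : Prop :=
  ∃ S : Set (MvPolynomial (Fin n × Fin n) ℂ), ∀ g : GL (Fin n) ℂ,
    g ∈ H ↔ ∀ p ∈ S, MvPolynomial.eval (fun ij => (g : Matrix (Fin n) (Fin n) ℂ) ij.1 ij.2) p = 0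

/-- A reductive linear algebraic group over `ℂ`: a Zariski closed subgroup of `GL_n(ℂ)` with
trivial unipotent radical, that is, whose only Zariski closed normal subgroup consisting of
unipotent matrices is the trivial one (in characteristic zero such subgroups are connected). -/
structure IsReductiveLinearGroup {n : ℕ} (H : Subgroup (GL (Fin n) ℂ)) : Prop where
  isZariskiClosed : IsZariskiClosed H
  eq_bot_of_unipotent : ∀ U : Subgroup (GL (Fin n) ℂ), U ≤ H → IsZariskiClosed U →
    (∀ h ∈ H, ∀ u ∈ U, h * u * h⁻¹ ∈ U) →
    (∀ u ∈ U, IsNilpotent ((u : Matrix (Fin n) (Fin n) ℂ) - 1)) → U = ⊥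

/-- A complex reductive Lie group: a complex Lie group `G` that is isomorphic, as a complex Lie
group, to a reductive linear algebraic group over `ℂ`. The isomorphism is given as a
homomorphism `ρ` into some `GL_n(ℂ)` that is an embedding of complex manifolds (a topological
embedding which is holomorphic and has injective differential; for a homomorphism it is enough to
ask the latter at the identity) and whose range is such a group. No connectedness is assumed. -/
def IsComplexReductive (E : Type*) [NormedAddCommGroup E] [NormedSpace ℂ E]
    (G : Type*) [TopologicalSpace G] [ChartedSpace E G] [Group G] : Prop :=
  ∃ (n : ℕ) (ρ : G →* GL (Fin n) ℂ),
    Topology.IsEmbedding ρ ∧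
    (∀ i j, ContMDiff 𝓘(ℂ, E) 𝓘(ℂ, ℂ) ω
      (fun g : G => (ρ g : Matrix (Fin n) (Fin n) ℂ) i j)) ∧
    (∀ v : GroupLieAlgebra 𝓘(ℂ, E) G,
      (∀ i j, mfderiv 𝓘(ℂ, E) 𝓘(ℂ, ℂ)
        (fun g : G => (ρ g : Matrix (Fin n) (Fin n) ℂ) i j) 1 v = 0) → v = 0) ∧
    IsReductiveLinearGroup ρ.range

/-! ### Fundamental groups of closed non-orientable surfaces -/

/-- The word `x₁² x₂² ⋯ x_h²` in the free group on `x₁, …, x_h`. -/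
def surfaceRelator (h : ℕ) : FreeGroup (Fin h) :=
  (List.ofFn fun i : Fin h => FreeGroup.of i ^ 2).prod

/-- The group `Π` is generated by `x₁, …, x_h` subject to the single relation
`x₁² x₂² ⋯ x_h² = 1`: this is the fundamental group of the connected sum of `h` copies of the
real projective plane, with its standard generators. -/
structure IsNonorientableSurfaceGroup {Γ : Type*} [Group Γ] {h : ℕ} (x : Fin h → Γ) : Prop where
  generates : Function.Surjective (FreeGroup.lift x)
  relations : (FreeGroup.lift x).ker = Subgroup.normalClosure {surfaceRelator h}

end

/-!
Write `Γ = F / ⟪r⟫` with `F` free and `r = x₁² ⋯ x_h²`. A 2-cocycle of `Γ` pulls back to a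
coboundary on `F`. The value at `r` of a primitive, taken relative to its value at `1`, is
determined up to the values at `r` of derivations of `F`, and it is such a value exactly if the
class of the cocycle vanishes. Hence `H²(Γ, V)` embeds in the quotient of `V` by these values, and
they form `∑ᵢ im (ρ(xᵢ) + 1)`, because a derivation `D` sends `x²` to `(ρ(x) + 1) (D x)`. The
embedding is onto if for each `a ∈ V` some group containing `V` has elements which act on `V` by
conjugation as the `ρ(xᵢ)` do and whose squares multiply to `a`. If `h ≥ 2`, there are such elements
in an amalgam of two copies of `V ⋊ F` over `V ⋊ ℤ`.

It remains to find a nondegenerate `Ad`-invariant form on `𝔤`, for which the orthogonal complement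
of `∑ᵢ im (Ad(xᵢ) + 1)` is `⋂ᵢ ker (Ad(xᵢ) + 1)`. For a reductive `G ≤ GL_n(ℂ)` the trace form
`tr (X Y)` works. Let `X` be in its radical, with semisimple part `diag(d)` in a suitable basis. As
`G` is Zariski closed, `t ↦ exp (t diag(f d))` lies in `G` for every additive `f : ℂ → ℂ`. Taking
`f` with values in `ℚ`, the condition `∑ dᵢ f(dᵢ) = 0` gives `∑ f(dᵢ)² = 0`, so `d = 0` and `X` is
nilpotent. By Engel's theorem the radical then generates a nilpotent algebra `𝔄`, and `G ∩ (1 + 𝔄)`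
is a unipotent normal Zariski closed subgroup, hence trivial. It contains `exp (t X)`, so `X = 0`.
-/

/-! ### Derivations and 2-cocycles on free groups -/

section Primitives

variable {k V G : Type*} [CommRing k] [AddCommGroup V] [Module k V] [Group G]

/-- A derivation (crossed homomorphism) with values in a representation. -/
def IsDerivation (ρ : Representation k G V) (D : G → V) : Prop :=
  ∀ u v, D (u * v) = ρ u (D v) + D u

/-- A 1-cochain `β` whose coboundary is `-c`. The sign makes `IsPrimitive ρ 0` the condition
`IsDerivation ρ`. -/
def IsPrimitive (ρ : Representation k G V) (c : G × G → V) (β : G → V) : Prop :=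
  ∀ u v, β (u * v) = ρ u (β v) + β u + c (u, v)

/-- An inhomogeneous 2-cocycle. -/
def IsTwoCocycle (ρ : Representation k G V) (c : G × G → V) : Prop :=
  ∀ u v w, c (u * v, w) + c (u, v) = ρ u (c (v, w)) + c (u, v * w)

variable {ρ : Representation k G V} {c : G × G → V} {β γ D : G → V}

theorem IsDerivation.map_one (hD : IsDerivation ρ D) : D 1 = 0 := by
  simpa using hD 1 1

theorem IsPrimitive.apply_one_left (hβ : IsPrimitive ρ c β) (u : G) : c (1, u) = -β 1 := by
  have h := hβ 1 u
  rw [one_mul, map_one, Module.End.one_apply, add_assoc] at h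
  exact eq_neg_of_add_eq_zero_right (left_eq_add.1 h)

theorem IsPrimitive.sub_isDerivation (hβ : IsPrimitive ρ c β) (hγ : IsPrimitive ρ c γ) :
    IsDerivation ρ (β - γ) := fun u v => by
  simp only [Pi.sub_apply, hβ u v, hγ u v, map_sub]
  abel

theorem IsPrimitive.sub_derivation (hβ : IsPrimitive ρ c β) (hD : IsDerivation ρ D) :
    IsPrimitive ρ c (β - D) := fun u v => by
  simp only [Pi.sub_apply, hβ u v, hD u v, map_sub]
  abel

theorem IsPrimitive.isTwoCocycle (hβ : IsPrimitive ρ c β) : IsTwoCocycle ρ c := by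
  intro u v w
  have h : β (u * v * w) = β (u * (v * w)) := by rw [mul_assoc]
  rw [hβ, hβ, hβ, hβ] at h
  simp only [map_mul, map_add, Module.End.mul_apply] at h
  rw [← sub_eq_zero] at h ⊢
  rw [← h]
  abel

theorem IsPrimitive.comp {H : Type*} [Group H] (hβ : IsPrimitive ρ c β) (π : H →* G) :
    IsPrimitive (ρ.comp π) (fun g => c (π g.1, π g.2)) (β ∘ π) := fun u v => by
  simp [hβ (π u) (π v)]

/-- The values at `g` of the derivations with values in `ρ`. -/
def derivationValues (ρ : Representation k G V) (g : G) : Submodule k V where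
  carrier := {a | ∃ D, IsDerivation ρ D ∧ D g = a}
  zero_mem' := ⟨0, fun _ _ => by simp, rfl⟩
  add_mem' := by
    rintro _ _ ⟨D, hD, rfl⟩ ⟨D', hD', rfl⟩
    refine ⟨D + D', fun u v => ?_, rfl⟩
    simp only [Pi.add_apply, hD u v, hD' u v, map_add]
    abel
  smul_mem' := by
    rintro t _ ⟨D, hD, rfl⟩
    exact ⟨t • D, fun u v => by simp [hD u v], rfl⟩

end Primitives

section FreeGroupCohomology

variable {k V G ι : Type*} [CommRing k] [AddCommGroup V] [Module k V] [Group G]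

/-- A representation, viewed as an action by automorphisms of the underlying group written
multiplicatively, as needed to form a semidirect product. -/
def mulAutOfRep (ρ : Representation k G V) : G →* MulAut (Multiplicative V) where
  toFun g :=
    { toFun := fun m => .ofAdd (ρ g m.toAdd)
      invFun := fun m => .ofAdd (ρ g⁻¹ m.toAdd)
      left_inv := fun m => by simp
      right_inv := fun m => by simp
      map_mul' := fun m n => by simp }
  map_one' := by ext m; simp
  map_mul' g h := by ext m; simp

@[simp]
theorem mulAutOfRep_apply (ρ : Representation k G V) (g : G) (m : Multiplicative V) :
    mulAutOfRep ρ g m = .ofAdd (ρ g m.toAdd) := rfl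

theorem exists_isDerivation_freeGroup (ρ : Representation k (FreeGroup ι) V) (m : ι → V) :
    ∃ D, IsDerivation ρ D ∧ ∀ i, D (.of i) = m i := by
  -- Derivations correspond to splittings of the projection of `V ⋊ F` to `F`.
  let ψ : FreeGroup ι →* Multiplicative V ⋊[mulAutOfRep ρ] FreeGroup ι :=
    FreeGroup.lift fun i => ⟨.ofAdd (m i), .of i⟩
  have hψ : SemidirectProduct.rightHom.comp ψ = MonoidHom.id _ := by
    ext i; simp [ψ]
  have hright : ∀ u, (ψ u).right = u := DFunLike.congr_fun hψ
  exact ⟨fun u => (ψ u).left.toAdd, fun u v => by simp [hright, add_comm], fun i => by simp [ψ]⟩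

/-- The diagonal action on the functions from a group to a representation. The resulting
representation is acyclic. -/
def functionRep (ρ : Representation k G V) : Representation k G (G → V) where
  toFun g :=
    { toFun := fun m h => ρ g (m (g⁻¹ * h))
      map_add' := fun m n => by ext h; simp
      map_smul' := fun c m => by ext h; simp }
  map_one' := by ext m; simp
  map_mul' g h := LinearMap.ext fun m => by ext j; simp [mul_assoc]

@[simp]
theorem functionRep_apply (ρ : Representation k G V) (g : G) (m : G → V) (h : G) :
    functionRep ρ g m h = ρ g (m (g⁻¹ * h)) := rfl

theorem IsTwoCocycle.isPrimitive_functionRep {ρ : Representation k G V} {c : G × G → V}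
    (hc : IsTwoCocycle ρ c) :
    IsPrimitive (functionRep ρ) (fun g _ => c g) fun u h => -c (u, u⁻¹ * h) := fun u v => by
  ext h
  have h' := hc u v (v⁻¹ * (u⁻¹ * h))
  simp only [mul_inv_cancel_left] at h'
  simp only [Pi.add_apply, functionRep_apply, map_neg, mul_inv_rev, mul_assoc,
    eq_sub_of_add_eq h']
  abel

theorem IsPrimitive.apply_eq_apply_of_freeGroup {ρ : Representation k (FreeGroup ι) V}
    {c : FreeGroup ι × FreeGroup ι → V} {β : FreeGroup ι → FreeGroup ι → V}
    (hβ : IsPrimitive (functionRep ρ) (fun g _ => c g) β)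
    (hι : ∀ i g h, β (.of i) g = β (.of i) h) (u g h : FreeGroup ι) : β u g = β u h := by
  have hβ' : ∀ u v g, β (u * v) g = ρ u (β v (u⁻¹ * g)) + β u g + c (u, v) := fun u v g =>
    congrFun (hβ u v) g
  have h_one : ∀ g, β 1 g = -c (1, 1) := fun g => by
    rw [← neg_eq_iff_eq_neg]
    exact (congrFun (hβ.apply_one_left 1) g).symm
  induction u using FreeGroup.induction_on generalizing g h with
  | C1 => rw [h_one, h_one]
  | of i => exact hι i g h
  | inv_of i _ =>
    have h_inv : ∀ g, β (.of i)⁻¹ g =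
        -c (1, 1) - c ((.of i)⁻¹, .of i) - ρ (.of i)⁻¹ (β (.of i) 1) := fun g => by
      have := hβ' (.of i)⁻¹ (.of i) g
      rw [inv_mul_cancel, h_one, hι i _ 1] at this
      rw [this]
      abel
    rw [h_inv, h_inv]
  | mul u v hu hv => rw [hβ', hβ', hu g h, hv (u⁻¹ * g) (u⁻¹ * h)]

theorem exists_isPrimitive_freeGroup {ρ : Representation k (FreeGroup ι) V}
    {c : FreeGroup ι × FreeGroup ι → V} (hc : IsTwoCocycle ρ c) : ∃ β, IsPrimitive ρ c β := by
  -- `c` becomes a coboundary in the functions on the free group; correcting a primitive there by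
  -- a derivation so that it vanishes on the generators makes all of its values constant.
  have hα := hc.isPrimitive_functionRep
  obtain ⟨D, hD, hDι⟩ := exists_isDerivation_freeGroup (functionRep ρ)
    fun i h => -c (.of i, (.of i)⁻¹ * h)
  have hβ := hα.sub_derivation hD
  set β : FreeGroup ι → FreeGroup ι → V := (fun u h => -c (u, u⁻¹ * h)) - D
  have hconst := hβ.apply_eq_apply_of_freeGroup fun i g h => by simp [β, hDι]
  refine ⟨fun u => β u 1, fun u v => ?_⟩
  beta_reduce
  rw [hconst v 1 (u⁻¹ * 1)]
  exact congrFun (hβ u v) 1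

end FreeGroupCohomology

section ProductOfSquares

variable {k V G : Type*} [CommRing k] [AddCommGroup V] [Module k V] [Group G]

/-- The value at `y₀² ⋯ y_{n-1}²` of a derivation, as a function of the operators `S i` by which
the `y i` act and of the values `m i` of the derivation at the `y i`. -/
def derivSqProd : ∀ {n : ℕ}, (Fin n → Module.End k V) → (Fin n → V) → V
  | 0, _, _ => 0
  | _ + 1, S, m => (S 0 ^ 2) (derivSqProd (Fin.tail S) (Fin.tail m)) + (S 0 + 1) (m 0)

theorem IsDerivation.map_prod_sq {ρ : Representation k G V} {D : G → V} (hD : IsDerivation ρ D) :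
    ∀ {n : ℕ} (y : Fin n → G),
      D (List.ofFn fun i => y i ^ 2).prod = derivSqProd (fun i => ρ (y i)) (fun i => D (y i))
  | 0, _ => by simp [derivSqProd, hD.map_one]
  | n + 1, y => by
    rw [List.ofFn_succ, List.prod_cons, hD, hD.map_prod_sq fun i => y i.succ, pow_two, hD (y 0)]
    simp [derivSqProd, pow_two, Fin.tail_def]

theorem iSup_fin_succ {α : Type*} [CompleteLattice α] {n : ℕ} (f : Fin (n + 1) → α) :
    ⨆ i, f i = f 0 ⊔ ⨆ i : Fin n, f i.succ := by
  simp only [iSup, ← sSup_insert, Fin.range_fin_succ f]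
  rfl

theorem sq_apply_eq_add (S : Module.End k V) (v : V) : (S ^ 2) v = v + (S + 1) (S v - v) := by
  simp [pow_two]

theorem derivSqProd_mem : ∀ {n : ℕ} (S : Fin n → Module.End k V) (m : Fin n → V),
    derivSqProd S m ∈ ⨆ i, LinearMap.range (S i + 1)
  | 0, _, _ => zero_mem _
  | n + 1, S, m => by
    rw [derivSqProd, sq_apply_eq_add, iSup_fin_succ, sup_comm, add_assoc, ← map_add]
    exact Submodule.add_mem_sup (derivSqProd_mem (Fin.tail S) (Fin.tail m)) ⟨_, rfl⟩

theorem exists_derivSqProd_eq : ∀ {n : ℕ} (S : Fin n → Module.End k V) {a : V},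
    a ∈ ⨆ i, LinearMap.range (S i + 1) → ∃ m, derivSqProd S m = a
  | 0, _, a, ha => by
    rw [iSup_of_empty, Submodule.mem_bot] at ha
    exact ⟨0, ha.symm⟩
  | n + 1, S, a, ha => by
    rw [iSup_fin_succ, Submodule.mem_sup] at ha
    obtain ⟨_, ⟨b, rfl⟩, a', ha', rfl⟩ := ha
    obtain ⟨m, hm⟩ := exists_derivSqProd_eq (Fin.tail S) ha'
    refine ⟨Fin.cons (b - (S 0 a' - a')) m, ?_⟩
    rw [derivSqProd, Fin.tail_cons, hm, sq_apply_eq_add, Fin.cons_zero, add_assoc, ← map_add,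
      add_sub_cancel, add_comm]

theorem derivationValues_prod_sq {n : ℕ} (ρ : Representation k (FreeGroup (Fin n)) V) :
    derivationValues ρ (surfaceRelator n) = ⨆ i, LinearMap.range (ρ (.of i) + 1) := by
  ext a
  constructor
  · rintro ⟨D, hD, rfl⟩
    rw [surfaceRelator, hD.map_prod_sq]
    exact derivSqProd_mem _ _
  · intro ha
    obtain ⟨m, rfl⟩ := exists_derivSqProd_eq _ ha
    obtain ⟨D, hD, hm⟩ := exists_isDerivation_freeGroup ρ m
    exact ⟨D, hD, by simp only [surfaceRelator, hD.map_prod_sq, hm]⟩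

end ProductOfSquares

/-! ### Amalgams and the surface relator -/

section Amalgam

open SemidirectProduct

universe u v

variable {N : Type u} {H : Type v} [CommGroup N] [Group H] {α : H →* MulAut N} {γ : MulAut N}

theorem mul_inl_eq (t : N ⋊[α] H) (v : N) : t * inl v = inl (α t.right v) * t := by
  ext
  · simp [mul_comm]
  · simp

theorem right_zpow (t : N ⋊[α] H) (z : ℤ) : (t ^ z).right = t.right ^ z :=
  map_zpow rightHom t z

/-- The homomorphism from `N ⋊ ℤ` which extends the inclusion of `N` and maps the generator of `ℤ`
to `t`. -/
def liftZPowers (t : N ⋊[α] H) (ht : α t.right = γ) :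
    N ⋊[zpowersHom (MulAut N) γ] Multiplicative ℤ →* N ⋊[α] H :=
  SemidirectProduct.lift inl (zpowersHom _ t) fun z => MonoidHom.ext fun v => by
    simp only [MonoidHom.comp_apply, MulEquiv.coe_toMonoidHom]
    rw [zpowersHom_apply, zpowersHom_apply, MulAut.conj_apply, eq_mul_inv_iff_mul_eq, mul_inl_eq,
      right_zpow, map_zpow, ht]

theorem liftZPowers_injective {t : N ⋊[α] H} (ht : α t.right = γ)
    (hord : ¬IsOfFinOrder t.right) : Function.Injective (liftZPowers t ht) := by
  rw [injective_iff_map_eq_one]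
  rintro ⟨v, z⟩ hvz
  replace hvz : inl v * t ^ z.toAdd = 1 := hvz
  have hz : z.toAdd = 0 := injective_zpow_iff_not_isOfFinOrder.2 hord <| by
    simpa [right_zpow] using congrArg right hvz
  rw [hz, zpow_zero, mul_one] at hvz
  ext
  · exact congrArg (fun w : N ⋊[α] H => w.left) hvz
  · exact hz

theorem exists_amalgam {s t : N ⋊[α] H} (hst : α s.right = α t.right)
    (hs : ¬IsOfFinOrder s.right) (ht : ¬IsOfFinOrder t.right) :
    ∃ (E : Type max u v) (_ : Group E) (j₁ j₂ : N ⋊[α] H →* E),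
      Function.Injective (j₁.comp inl) ∧ j₁.comp inl = j₂.comp inl ∧ j₁ s = j₂ t := by
  -- Amalgamate along `N ⋊ ℤ`, with the generator of `ℤ` sent to `s` and to `t`.
  let f : Bool → N ⋊[zpowersHom (MulAut N) (α s.right)] Multiplicative ℤ →* N ⋊[α] H :=
    fun b => cond b (liftZPowers s rfl) (liftZPowers t hst.symm)
  have hf : ∀ b, Function.Injective (f b) := by
    rintro (_ | _)
    · exact liftZPowers_injective hst.symm ht
    · exact liftZPowers_injective rfl hs
  have hinl : ∀ b v, f b (inl v) = inl v := by
    rintro (_ | _) v <;> simp [f, liftZPowers]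
  have hgen : ∀ b, f b (inr (.ofAdd 1)) = cond b s t := by
    rintro (_ | _) <;> simp [f, liftZPowers]
  have hbase : ∀ b v, Monoid.PushoutI.of (φ := f) b (inl v) = Monoid.PushoutI.base f (inl v) :=
    fun b v => by rw [← Monoid.PushoutI.of_apply_eq_base f b, hinl]
  refine ⟨Monoid.PushoutI f, inferInstance, Monoid.PushoutI.of (φ := f) true,
    Monoid.PushoutI.of (φ := f) false, fun v w hvw => ?_, MonoidHom.ext fun v => ?_, ?_⟩
  · simp only [MonoidHom.comp_apply, hbase] at hvw
    exact inl_injective (Monoid.PushoutI.base_injective hf hvw)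
  · exact (hbase true v).trans (hbase false v).symm
  · have hs := Monoid.PushoutI.of_apply_eq_base f true (inr (.ofAdd 1))
    have ht := Monoid.PushoutI.of_apply_eq_base f false (inr (.ofAdd 1))
    rw [hgen] at hs ht
    exact hs.trans ht.symm

end Amalgam

section SurfaceRelator

universe u

open SemidirectProduct

variable {k ι : Type*} {V : Type u} [CommRing k] [AddCommGroup V] [Module k V]

theorem prod_sq_ne_one {n : ℕ} (hn : n ≠ 0) (e : Fin n → ι) :
    (List.ofFn fun i => FreeGroup.of (e i) ^ 2).prod ≠ 1 := by
  let f : FreeGroup ι →* Multiplicative ℤ := FreeGroup.lift fun _ => .ofAdd 1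
  have hf : f ∘ (fun i => FreeGroup.of (e i) ^ 2) = fun _ => .ofAdd (2 : ℤ) := by
    ext i
    simp [f, ← ofAdd_add, pow_two]
  intro h_one
  have h_exp := congrArg (fun w => (f w).toAdd) h_one
  simp [map_list_prod, List.map_ofFn, hf, List.ofFn_const, hn] at h_exp

theorem surfaceRelator_succ (n : ℕ) : surfaceRelator (n + 1) =
    FreeGroup.of 0 ^ 2 * (List.ofFn fun i : Fin n => FreeGroup.of i.succ ^ 2).prod := by
  rw [surfaceRelator, List.ofFn_succ, List.prod_cons]

theorem map_mul_eq_of_generators {E : Type*} [Group E] (ρ : Representation k (FreeGroup ι) V)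
    (i : Multiplicative V →* E) (ψ : FreeGroup ι →* E)
    (hψ : ∀ e v, ψ (.of e) * i v = i (mulAutOfRep ρ (.of e) v) * ψ (.of e)) (u : FreeGroup ι)
    (v : Multiplicative V) : ψ u * i v = i (mulAutOfRep ρ u v) * ψ u := by
  induction u using FreeGroup.induction_on generalizing v with
  | C1 => simp
  | of e => exact hψ e v
  | inv_of e he =>
    rw [map_inv, inv_mul_eq_iff_eq_mul, ← mul_assoc, he, mul_inv_cancel_right, map_inv,
      MulAut.apply_inv_self]
  | mul u w hu hw => rw [map_mul, mul_assoc, hw, ← mul_assoc, hu, mul_assoc, map_mul,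
      MulAut.mul_apply]

theorem exists_group_relator_eq {h : ℕ} (hh : 2 ≤ h) (ρ : Representation k (FreeGroup (Fin h)) V)
    (hρ : ρ (surfaceRelator h) = 1) (a : V) :
    ∃ (E : Type u) (_ : Group E) (i : Multiplicative V →* E) (ψ : FreeGroup (Fin h) →* E),
      Function.Injective i ∧ (∀ u v, ψ u * i v = i (mulAutOfRep ρ u v) * ψ u) ∧
      ψ (surfaceRelator h) = i (.ofAdd a) := by
  obtain ⟨n, rfl⟩ : ∃ n, h = n + 1 := ⟨h - 1, by omega⟩
  -- Generate by `x₀` from one copy of `V ⋊ F` and the other `xᵢ` from a second copy. In the amalgam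
  -- `x₀²` is identified with `a` times the inverse of the product of the other squares.
  let x : Fin (n + 1) → FreeGroup (Fin (n + 1)) := .of
  let tail := (List.ofFn fun i : Fin n => x i.succ ^ 2).prod
  let s : Multiplicative V ⋊[mulAutOfRep ρ] FreeGroup (Fin (n + 1)) := inr (x 0 ^ 2)
  let t : Multiplicative V ⋊[mulAutOfRep ρ] FreeGroup (Fin (n + 1)) := ⟨.ofAdd a, tail⁻¹⟩
  have hst : mulAutOfRep ρ s.right = mulAutOfRep ρ t.right := by
    have hx : mulAutOfRep ρ (x 0 ^ 2) * mulAutOfRep ρ tail = 1 := by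
      rw [← map_mul, ← surfaceRelator_succ]
      ext v
      simp [hρ]
    rw [map_inv, ← eq_inv_of_mul_eq_one_left hx]
    rfl
  have hs : ¬IsOfFinOrder s.right := fun hfin => by
    simpa [x] using (isOfFinOrder_iff_eq_one (x 0 ^ 2)).1 hfin
  have ht : ¬IsOfFinOrder t.right := not_isOfFinOrder_of_isMulTorsionFree
    (inv_ne_one.2 (prod_sq_ne_one (by omega) Fin.succ))
  obtain ⟨E, _, j₁, j₂, hinj, hj, hjst⟩ := exists_amalgam hst hs ht
  let ψ : FreeGroup (Fin (n + 1)) →* E :=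
    FreeGroup.lift (Fin.cases (j₁ (inr (x 0))) fun i => j₂ (inr (x i.succ)))
  have hψ₀ : ψ (x 0) = j₁ (inr (x 0)) := FreeGroup.lift_apply_of
  have hψ : ∀ i : Fin n, ψ (x i.succ) = j₂ (inr (x i.succ)) := fun i => FreeGroup.lift_apply_of
  refine ⟨E, inferInstance, j₁.comp inl, ψ, hinj, map_mul_eq_of_generators ρ _ ψ fun e v => ?_, ?_⟩
  · cases e using Fin.cases with
    | zero => rw [hψ₀, MonoidHom.comp_apply, ← map_mul, mul_inl_eq, map_mul]; rfl
    | succ e => rw [hj, hψ, MonoidHom.comp_apply, ← map_mul, mul_inl_eq, map_mul]; rfl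
  · have hψ_tail : ψ tail = j₂ (inr tail) := by
      simp only [tail, map_list_prod, List.map_ofFn, Function.comp_def, map_pow, hψ]
    calc ψ (surfaceRelator (n + 1)) = j₁ s * j₂ (inr tail) := by
          rw [surfaceRelator_succ, map_mul, map_pow, hψ₀, hψ_tail, ← map_pow, ← map_pow]
      _ = j₂ (inl (.ofAdd a)) := by
          rw [hjst, ← map_mul, show t = _ from mk_eq_inl_mul_inr .., map_inv, inv_mul_cancel_right]
      _ = j₁.comp inl (.ofAdd a) := by rw [hj]; rfl

end SurfaceRelator

/-! ### Second cohomology of one-relator groups -/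

section OneRelator

variable {k V Γ ι : Type*} [CommRing k] [AddCommGroup V] [Module k V] [Group Γ]
  {ρ : Representation k Γ V} {π : FreeGroup ι →* Γ} {r : FreeGroup ι} {c : Γ × Γ → V}
  {β : FreeGroup ι → V}

theorem map_relator_eq_one (hker : π.ker = Subgroup.normalClosure {r}) : π r = 1 := by
  rw [← MonoidHom.mem_ker, hker]
  exact Subgroup.subset_normalClosure rfl

/-- The pairs of a 2-cochain `c` on `Γ` and a primitive `β` of its pullback along `π`. If `Γ` is
presented by generators `ι` and the relator `r`, then `β r - β 1` is the transgression of `c`. -/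
def pullbackPrimitives (ρ : Representation k Γ V) (π : FreeGroup ι →* Γ) :
    Submodule k ((Γ × Γ → V) × (FreeGroup ι → V)) where
  carrier := {p | IsPrimitive (ρ.comp π) (fun g => p.1 (π g.1, π g.2)) p.2}
  zero_mem' := fun _ _ => by simp
  add_mem' {p q} hp hq := fun u v => by
    simp only [Prod.snd_add, Prod.fst_add, Pi.add_apply, hp u v, hq u v, map_add]
    abel
  smul_mem' t p hp := fun u v => by simp [hp u v]

theorem mem_pullbackPrimitives : (c, β) ∈ pullbackPrimitives ρ π ↔
    IsPrimitive (ρ.comp π) (fun g => c (π g.1, π g.2)) β :=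
  Iff.rfl

theorem isTwoCocycle_of_mem_pullbackPrimitives (hπ : Function.Surjective π)
    (hβ : (c, β) ∈ pullbackPrimitives ρ π) : IsTwoCocycle ρ c := by
  intro f g j
  obtain ⟨u, rfl⟩ := hπ f
  obtain ⟨v, rfl⟩ := hπ g
  obtain ⟨w, rfl⟩ := hπ j
  simpa using (mem_pullbackPrimitives.1 hβ).isTwoCocycle u v w

theorem apply_one_left_of_mem_pullbackPrimitives (hπ : Function.Surjective π)
    (hβ : (c, β) ∈ pullbackPrimitives ρ π) (g : Γ) : c (1, g) = -β 1 := by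
  obtain ⟨u, rfl⟩ := hπ g
  simpa using (mem_pullbackPrimitives.1 hβ).apply_one_left u

theorem apply_mul_eq_of_mem_pullbackPrimitives (hπ : Function.Surjective π)
    (hker : π.ker = Subgroup.normalClosure {r}) (hβ : (c, β) ∈ pullbackPrimitives ρ π)
    (hr : β r = β 1) {n : FreeGroup ι} (hn : π n = 1) (u : FreeGroup ι) : β (n * u) = β u := by
  have hmul : ∀ u v, β (u * v) = ρ (π u) (β v) + β u + c (π u, π v) := hβ
  -- The elements of the kernel under translation by which `β` is invariant form a normal subgroup.
  let S : Subgroup (FreeGroup ι) :=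
    { carrier := {n | π n = 1 ∧ ∀ u, β (n * u) = β u}
      one_mem' := ⟨map_one π, fun u => by rw [one_mul]⟩
      mul_mem' := fun ⟨ha, ha'⟩ ⟨hb, hb'⟩ =>
        ⟨by rw [map_mul, ha, hb, mul_one], fun u => by rw [mul_assoc, ha', hb']⟩
      inv_mem' := fun {n} ⟨hn, hn'⟩ =>
        ⟨by rw [map_inv, hn, inv_one], fun u => by rw [← hn' (n⁻¹ * u), mul_inv_cancel_left]⟩ }
  have hS : S.Normal := ⟨fun n ⟨hn, hn'⟩ g => ⟨by simp [hn], fun u => by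
    rw [mul_assoc, mul_assoc, hmul, map_mul, hn, one_mul, hn', ← hmul, mul_inv_cancel_left]⟩⟩
  have hrS : r ∈ S := ⟨map_relator_eq_one hker, fun u => by
    rw [hmul, map_relator_eq_one hker, apply_one_left_of_mem_pullbackPrimitives hπ hβ, hr]
    simp⟩
  exact (Subgroup.normalClosure_le_normal (Set.singleton_subset_iff.2 hrS)
    (hker ▸ MonoidHom.mem_ker.2 hn)).2 u

theorem exists_isPrimitive_of_mem_pullbackPrimitives (hπ : Function.Surjective π)
    (hker : π.ker = Subgroup.normalClosure {r}) (hβ : (c, β) ∈ pullbackPrimitives ρ π)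
    (hr : β r = β 1) : ∃ b, IsPrimitive ρ c b := by
  choose σ hσ using hπ
  have hfac : ∀ u, β (σ (π u)) = β u := fun u => by
    rw [← apply_mul_eq_of_mem_pullbackPrimitives (fun g => ⟨σ g, hσ g⟩) hker hβ hr
      (n := σ (π u) * u⁻¹) (by simp [hσ]) u, inv_mul_cancel_right]
  refine ⟨β ∘ σ, fun g j => ?_⟩
  have h := mem_pullbackPrimitives.1 hβ (σ g) (σ j)
  rw [← hfac, map_mul] at h
  simpa [hσ] using h

theorem exists_isPrimitive_iff_of_mem_pullbackPrimitives (hπ : Function.Surjective π)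
    (hker : π.ker = Subgroup.normalClosure {r}) (hβ : (c, β) ∈ pullbackPrimitives ρ π) :
    (∃ b, IsPrimitive ρ c b) ↔ β r - β 1 ∈ derivationValues (ρ.comp π) r := by
  constructor
  · rintro ⟨b, hb⟩
    have hD := (mem_pullbackPrimitives.1 hβ).sub_isDerivation (hb.comp π)
    refine ⟨_, hD, ?_⟩
    have h_one := hD.map_one
    simp only [Pi.sub_apply, Function.comp_apply, map_relator_eq_one hker, map_one,
      sub_eq_zero] at h_one ⊢
    rw [h_one]
  · rintro ⟨D, hD, hDr⟩
    refine exists_isPrimitive_of_mem_pullbackPrimitives hπ hker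
      ((mem_pullbackPrimitives.1 hβ).sub_derivation hD) ?_
    simp [hDr, hD.map_one]

theorem exists_eq_of_mem_ker {E : Type*} [Group E] {i : Multiplicative V →* E}
    {ψ : FreeGroup ι →* E} (hker : π.ker = Subgroup.normalClosure {r})
    (hψ : ∀ u v, ψ u * i v = i (mulAutOfRep (ρ.comp π) u v) * ψ u) (hr : ψ r ∈ i.range)
    {n : FreeGroup ι} (hn : π n = 1) : ∃ v : V, ψ n = i (.ofAdd v) := by
  have hnormal : (i.range.comap ψ).Normal := by
    refine ⟨?_⟩
    rintro n ⟨v, hv⟩ g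
    exact ⟨mulAutOfRep (ρ.comp π) g v, by simp [← hv, hψ]⟩
  have hle : Subgroup.normalClosure {r} ≤ i.range.comap ψ :=
    Subgroup.normalClosure_le_normal (Set.singleton_subset_iff.2 hr)
  obtain ⟨v, hv⟩ := hle (hker ▸ MonoidHom.mem_ker.2 hn)
  exact ⟨v.toAdd, hv.symm⟩

theorem exists_mem_pullbackPrimitives_of_group (hπ : Function.Surjective π)
    (hker : π.ker = Subgroup.normalClosure {r}) {E : Type*} [Group E]
    {i : Multiplicative V →* E} {ψ : FreeGroup ι →* E} (hi : Function.Injective i)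
    (hψ : ∀ u v, ψ u * i v = i (mulAutOfRep (ρ.comp π) u v) * ψ u) {a : V}
    (hr : ψ r = i (.ofAdd a)) :
    ∃ c β, (c, β) ∈ pullbackPrimitives ρ π ∧ β r - β 1 = a := by
  choose σ hσ using hπ
  have hβ : ∀ u, ∃ v : V, ψ u = i (.ofAdd v) * ψ (σ (π u)) := fun u => by
    obtain ⟨v, hv⟩ := exists_eq_of_mem_ker hker hψ ⟨_, hr.symm⟩
      (n := u * (σ (π u))⁻¹) (by simp [hσ])
    exact ⟨v, by rw [← hv, map_mul, map_inv, inv_mul_cancel_right]⟩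
  have hc : ∀ g : Γ × Γ, ∃ v : V, ψ (σ g.1) * ψ (σ g.2) = i (.ofAdd v) * ψ (σ (g.1 * g.2)) :=
    fun g => by
      obtain ⟨v, hv⟩ := exists_eq_of_mem_ker hker hψ ⟨_, hr.symm⟩
        (n := σ g.1 * σ g.2 * (σ (g.1 * g.2))⁻¹) (by simp [hσ])
      exact ⟨v, by rw [← hv, map_mul, map_inv, map_mul, inv_mul_cancel_right]⟩
  choose β hβ using hβ
  choose c hc using hc
  refine ⟨c, β, mem_pullbackPrimitives.2 fun u v => ?_, ?_⟩
  · have h : ψ (u * v) = i (.ofAdd (β u + ρ (π u) (β v) + c (π u, π v))) * ψ (σ (π (u * v))) := by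
      rw [map_mul, hβ u, hβ v, mul_assoc, ← mul_assoc (ψ (σ (π u))), hψ, mul_assoc,
        hc (π u, π v)]
      simp [hσ, mul_assoc]
    rw [hβ] at h
    have h_add := Multiplicative.ofAdd.injective (hi (mul_right_cancel h))
    rw [h_add]
    simp [add_comm]
  · have h_one := hβ 1
    have h_rel := hβ r
    rw [map_relator_eq_one hker, hr] at h_rel
    rw [map_one, map_one] at h_one
    refine Multiplicative.ofAdd.injective (hi ?_)
    rw [h_rel, ofAdd_sub, map_div, div_eq_mul_inv, eq_inv_of_mul_eq_one_right h_one.symm]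

end OneRelator

section SecondCohomology

universe u

variable {k V Γ : Type u} {ι : Type*} [CommRing k] [AddCommGroup V] [Module k V] [Group Γ]
  {ρ : Representation k Γ V} {π : FreeGroup ι →* Γ} {r : FreeGroup ι}

theorem mem_cocycles₂_iff_isTwoCocycle {c : Γ × Γ → V} :
    c ∈ groupCohomology.cocycles₂ (Rep.of ρ) ↔ IsTwoCocycle ρ c :=
  groupCohomology.mem_cocycles₂_iff (A := Rep.of ρ) c

theorem H2π_eq_zero_iff_exists_isPrimitive (c : groupCohomology.cocycles₂ (Rep.of ρ)) :
    (groupCohomology.H2π (Rep.of ρ)).hom c = 0 ↔ ∃ b, IsPrimitive ρ c.1 b := by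
  refine (groupCohomology.H2π_eq_zero_iff c).trans ⟨?_, ?_⟩
  · rintro ⟨b, hb⟩
    refine ⟨-b, fun g j => ?_⟩
    have h : ρ g (b j) - b (g * j) + b g = c.1 (g, j) := congrFun hb (g, j)
    simp only [Pi.neg_apply, map_neg, ← h]
    abel
  · rintro ⟨b, hb⟩
    refine ⟨-b, funext fun g => ?_⟩
    change ρ g.1 (-b g.2) - -b (g.1 * g.2) + -b g.1 = c.1 g
    rw [hb g.1 g.2, map_neg]
    abel

theorem nonempty_linearEquiv_of_ker_eq {P M N : Type*} [AddCommGroup P] [Module k P]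
    [AddCommGroup M] [Module k M] [AddCommGroup N] [Module k N] {f : P →ₗ[k] M} {g : P →ₗ[k] N}
    (hf : Function.Surjective f) (hg : Function.Surjective g)
    (h : LinearMap.ker f = LinearMap.ker g) : Nonempty (M ≃ₗ[k] N) :=
  ⟨(f.quotKerEquivOfSurjective hf).symm ≪≫ₗ Submodule.quotEquivOfEq _ _ h ≪≫ₗ
    g.quotKerEquivOfSurjective hg⟩

theorem nonempty_H2_equiv_of_transgression_surjective (hπ : Function.Surjective π)
    (hker : π.ker = Subgroup.normalClosure {r})
    (hr : ∀ a, ∃ c β, (c, β) ∈ pullbackPrimitives ρ π ∧ β r - β 1 = a) :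
    Nonempty (groupCohomology (Rep.of ρ) 2 ≃ₗ[k] V ⧸ derivationValues (ρ.comp π) r) := by
  let P := pullbackPrimitives ρ π
  let toCocycle : P →ₗ[k] groupCohomology.cocycles₂ (Rep.of ρ) :=
    (LinearMap.fst k _ _ ∘ₗ P.subtype).codRestrict _ fun p =>
      mem_cocycles₂_iff_isTwoCocycle.2 (isTwoCocycle_of_mem_pullbackPrimitives hπ p.2)
  let transgression : P →ₗ[k] V :=
    { toFun := fun p => p.1.2 r - p.1.2 1
      map_add' := fun p q => add_sub_add_comm _ _ _ _
      map_smul' := fun a p => (smul_sub a (p.1.2 r) (p.1.2 1)).symm }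
  have h_cocycle : Function.Surjective toCocycle := fun c => by
    have hc := mem_cocycles₂_iff_isTwoCocycle.1 c.2
    obtain ⟨β, hβ⟩ := exists_isPrimitive_freeGroup (ρ := ρ.comp π)
      (c := fun g => c.1 (π g.1, π g.2)) fun u v w => by simpa using hc (π u) (π v) (π w)
    exact ⟨⟨(c.1, β), hβ⟩, rfl⟩
  have h_transgression : Function.Surjective transgression := fun a => by
    obtain ⟨c, β, hβ, rfl⟩ := hr a
    exact ⟨⟨(c, β), hβ⟩, rfl⟩
  have h_mk : Function.Surjective (groupCohomology.H2π (Rep.of ρ)).hom :=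
    (ModuleCat.epi_iff_surjective _).1 inferInstance
  refine nonempty_linearEquiv_of_ker_eq
    (f := (groupCohomology.H2π (Rep.of ρ)).hom ∘ₗ toCocycle)
    (g := (derivationValues (ρ.comp π) r).mkQ ∘ₗ transgression)
    (h_mk.comp h_cocycle)
    ((Submodule.mkQ_surjective _).comp h_transgression) ?_
  ext ⟨⟨c, β⟩, hβ⟩
  simp only [LinearMap.mem_ker, LinearMap.comp_apply, Submodule.mkQ_apply,
    Submodule.Quotient.mk_eq_zero]
  rw [H2π_eq_zero_iff_exists_isPrimitive]
  exact exists_isPrimitive_iff_of_mem_pullbackPrimitives hπ hker hβ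

end SecondCohomology

namespace IsNonorientableSurfaceGroup

universe u

variable {h : ℕ}

theorem nonempty_H2_equiv_quotient {k V Γ : Type u} [CommRing k] [AddCommGroup V] [Module k V]
    [Group Γ] {x : Fin h → Γ} (hx : IsNonorientableSurfaceGroup x) (hh : 2 ≤ h)
    (ρ : Representation k Γ V) :
    Nonempty (groupCohomology (Rep.of ρ) 2 ≃ₗ[k] V ⧸ ⨆ i, LinearMap.range (ρ (x i) + 1)) := by
  obtain ⟨e⟩ := nonempty_H2_equiv_of_transgression_surjective (ρ := ρ) hx.generates hx.relations
    fun a => by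
      obtain ⟨E, _, i, ψ, hi, hψ, hr⟩ := exists_group_relator_eq hh (ρ.comp (FreeGroup.lift x))
        (by rw [MonoidHom.comp_apply, map_relator_eq_one hx.relations, map_one]) a
      exact exists_mem_pullbackPrimitives_of_group hx.generates hx.relations hi hψ hr
  exact ⟨e ≪≫ₗ Submodule.quotEquivOfEq _ _ (by simp [derivationValues_prod_sq])⟩

theorem invariants_eq {k V Γ : Type*} [CommRing k] [AddCommGroup V] [Module k V] [Group Γ]
    {x : Fin h → Γ} (hx : IsNonorientableSurfaceGroup x) (ρ : Representation k Γ V) :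
    ρ.invariants = ⨅ i, LinearMap.ker (ρ (x i) - 1) := by
  ext v
  simp only [Representation.mem_invariants, Submodule.mem_iInf, LinearMap.mem_ker,
    LinearMap.sub_apply, Module.End.one_apply, sub_eq_zero]
  refine ⟨fun hv i => hv _, fun hv g => ?_⟩
  obtain ⟨u, rfl⟩ := hx.generates g
  induction u using FreeGroup.induction_on with
  | C1 => simp
  | of i => simpa using hv i
  | inv_of i hi => rw [map_inv, Representation.inv_apply_eq_iff, hi]
  | mul u w hu hw => rw [map_mul, map_mul, Module.End.mul_apply, hw, hu]

end IsNonorientableSurfaceGroup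

/-! ### Exponential polynomials and replicas -/

section ExponentialPolynomials

open Polynomial

/-- Exponential polynomials `∑ q_μ(t) e^{μ t}`, as formal expressions: the group algebra over `ℂ[X]`
of the additive group of exponents `μ`. -/
abbrev ExpPoly : Type := AddMonoidAlgebra ℂ[X] ℂ

/-- Evaluation of the coefficients of an exponential polynomial at `t`, and of its exponents through
an additive map `f`: the expression `∑ q_μ e^{μ}` is sent to `∑ q_μ(t) exp (f μ)`. The value at `t`
is obtained from `f μ = t μ`; other choices of `f` make sense because `f` need not be linear. -/
noncomputable def ExpPoly.eval (t : ℂ) (f : ℂ →+ ℂ) : ExpPoly →+* ℂ :=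
  AddMonoidAlgebra.liftNCRingHom (Polynomial.evalRingHom t)
    { toFun := fun μ => Complex.exp (f μ.toAdd)
      map_one' := by simp
      map_mul' := fun μ ν => by simp [Complex.exp_add] }
    fun _ _ => Commute.all _ _

theorem ExpPoly.eval_single (t : ℂ) (f : ℂ →+ ℂ) (μ : ℂ) (q : ℂ[X]) :
    ExpPoly.eval t f (AddMonoidAlgebra.single μ q) = q.eval t * Complex.exp (f μ) := by
  simp [ExpPoly.eval]

theorem ExpPoly.eval_algebraMap (t : ℂ) (f : ℂ →+ ℂ) (z : ℂ) :
    ExpPoly.eval t f (algebraMap ℂ ExpPoly z) = z := by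
  have h : algebraMap ℂ ExpPoly z = AddMonoidAlgebra.single 0 (C z) := rfl
  simp [h, ExpPoly.eval_single]

/-- The space of smooth functions of a complex variable. -/
def smoothFunctions : Submodule ℂ (ℂ → ℂ) where
  carrier := {f | ContDiff ℂ ∞ f}
  zero_mem' := (contDiff_const : ContDiff ℂ ∞ fun _ : ℂ => (0 : ℂ))
  add_mem' hf hg := ContDiff.add (Set.mem_ofPred_eq.mp hf) (Set.mem_ofPred_eq.mp hg)
  smul_mem' c _ hf := ContDiff.const_smul c (Set.mem_ofPred_eq.mp hf)

/-- Differentiation as an endomorphism of the space of smooth functions. -/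
noncomputable def smoothDeriv : Module.End ℂ smoothFunctions where
  toFun f := ⟨deriv f.1, (contDiff_infty_iff_deriv.1 f.2).2⟩
  map_add' f g := by
    ext t
    exact deriv_add ((contDiff_infty_iff_deriv.1 f.2).1 t) ((contDiff_infty_iff_deriv.1 g.2).1 t)
  map_smul' c f := by
    ext t
    exact deriv_const_smul c ((contDiff_infty_iff_deriv.1 f.2).1 t)

/-- The function `q(t) e^{μ t}`, a generalized eigenvector of differentiation. -/
noncomputable def polyMulExp (μ : ℂ) (q : ℂ[X]) : smoothFunctions :=
  ⟨fun t => q.eval t * Complex.exp (t * μ), by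
    have h1 : ContDiff ℂ ∞ fun t => q.eval t := Polynomial.contDiff_aeval q _
    have h2 : ContDiff ℂ ∞ fun t : ℂ => Complex.exp (t * μ) := by fun_prop
    exact h1.mul h2⟩

theorem polyMulExp_eq_zero_iff {μ : ℂ} {q : ℂ[X]} : polyMulExp μ q = 0 ↔ q = 0 := by
  refine ⟨fun h => Polynomial.funext fun t => ?_, fun h => ?_⟩
  · have ht : q.eval t * Complex.exp (t * μ) = 0 := congrFun (congrArg Subtype.val h) t
    simpa using (mul_eq_zero.1 ht).resolve_right (Complex.exp_ne_zero _)
  · ext t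
    simp [h, polyMulExp]

theorem smoothDeriv_polyMulExp (μ : ℂ) (q : ℂ[X]) :
    (smoothDeriv - algebraMap ℂ _ μ) (polyMulExp μ q) = polyMulExp μ (derivative q) := by
  ext t
  have h := ((q.hasDerivAt t).mul ((hasDerivAt_id t).mul_const μ).cexp).deriv
  change deriv (fun t => q.eval t * Complex.exp (t * μ)) t - μ * (q.eval t * Complex.exp (t * μ)) =
    (derivative q).eval t * Complex.exp (t * μ)
  refine (congrArg (· - _) h).trans ?_
  simp only [id_eq, one_mul]
  ring

theorem polyMulExp_mem_maxGenEigenspace (μ : ℂ) (q : ℂ[X]) :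
    polyMulExp μ q ∈ smoothDeriv.maxGenEigenspace μ := by
  have hpow (n : ℕ) : ((smoothDeriv - algebraMap ℂ _ μ) ^ n) (polyMulExp μ q) =
      polyMulExp μ (derivative^[n] q) := by
    induction n with
    | zero => rfl
    | succ n ih =>
      rw [pow_succ', Module.End.mul_apply, ih, smoothDeriv_polyMulExp, Function.iterate_succ_apply']
  rw [Module.End.mem_maxGenEigenspace]
  refine ⟨q.natDegree + 1, ?_⟩
  rw [← Algebra.algebraMap_eq_smul_one, hpow,
    Polynomial.iterate_derivative_eq_zero (Nat.lt_succ_self _), polyMulExp_eq_zero_iff]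

theorem ExpPoly.eq_zero_of_forall_eval_eq_zero (p : ExpPoly)
    (hp : ∀ t, ExpPoly.eval t (AddMonoidHom.mulLeft t) p = 0) : p = 0 := by
  have hsum : ∑ μ ∈ p.coeff.support, polyMulExp μ (p.coeff μ) = 0 := by
    ext t
    have ht := hp t
    rw [← AddMonoidAlgebra.sum_coeff_single p, Finsupp.sum, map_sum] at ht
    simp only [ExpPoly.eval_single] at ht
    rw [AddSubmonoidClass.coe_finsetSum, Finset.sum_apply]
    exact ht
  refine AddMonoidAlgebra.ext (Finsupp.ext fun μ => ?_)
  by_contra hμ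
  exact hμ <| polyMulExp_eq_zero_iff.1 <|
    (iSupIndep_iff_finsetSum_eq_zero_imp_eq_zero _).1
      (Module.End.independent_maxGenEigenspace smoothDeriv) _ _
      (fun ν _ => polyMulExp_mem_maxGenEigenspace ν _) hsum μ (Finsupp.mem_support_iff.2 hμ)

end ExponentialPolynomials

section ConjDiagonal

open Matrix

variable {m K : Type*} [Fintype m] [DecidableEq m] [Field K]

/-- The diagonal matrices in the basis given by the columns of `Q`, as an algebra homomorphism
`d ↦ Q diag(d) Q⁻¹`. -/
def conjDiagonal (Q : (Matrix m m K)ˣ) : (m → K) →ₐ[K] Matrix m m K where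
  toFun d := Q * diagonal d * (Q⁻¹ : (Matrix m m K)ˣ)
  map_one' := by simp
  map_mul' d d' := by
    rw [Pi.mul_def, ← diagonal_mul_diagonal]
    simp only [mul_assoc, Units.inv_mul_cancel_left]
  map_zero' := by simp
  map_add' d d' := by
    rw [Pi.add_def, ← diagonal_add, mul_add, add_mul]
  commutes' a := by
    rw [← diagonalAlgHom_apply (R := K), AlgHom.commutes, ← Algebra.commutes, mul_assoc,
      Units.mul_inv, mul_one]

theorem conjDiagonal_apply (Q : (Matrix m m K)ˣ) (d : m → K) :
    conjDiagonal Q d = Q * diagonal d * (Q⁻¹ : (Matrix m m K)ˣ) :=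
  rfl

theorem trace_conjDiagonal (Q : (Matrix m m K)ˣ) (d : m → K) :
    trace (conjDiagonal Q d) = ∑ i, d i := by
  rw [conjDiagonal_apply, trace_units_conj, trace_diagonal]

theorem commute_conjDiagonal_comp {A : Matrix m m K} {Q : (Matrix m m K)ˣ} {d : m → K}
    (h : Commute A (conjDiagonal Q d)) (f : K → K) : Commute A (conjDiagonal Q (f ∘ d)) := by
  obtain ⟨q, hq⟩ := (Polynomial.exists_eval_eq_iff d (f ∘ d)).2 fun i j hij => congrArg f hij
  have h_aeval : Polynomial.aeval d q = f ∘ d := funext fun i => by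
    rw [← hq, ← Pi.evalAlgHom_apply K (fun _ : m => K) i (Polynomial.aeval d q),
      ← Polynomial.aeval_algHom_apply, Pi.evalAlgHom_apply, Polynomial.coe_aeval_eq_eval]
  rw [← h_aeval, ← Polynomial.aeval_algHom_apply]
  exact Algebra.commute_of_mem_adjoin_singleton_of_commute
    (Polynomial.aeval_mem_adjoin_singleton K _) h

variable [IsAlgClosed K]

theorem exists_basis_apply_eq_smul {ι V : Type*} [AddCommGroup V] [Module K V]
    [FiniteDimensional K V] {f : Module.End K V} (hf : f.IsSemisimple) (b₀ : Module.Basis ι K V) :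
    ∃ (b : Module.Basis ι K V) (d : ι → K), ∀ i, f (b i) = d i • b i := by
  classical
  let eigenDecomp := DirectSum.isInternal_submodule_of_iSupIndep_of_iSup_eq_top
    f.eigenspaces_iSupIndep hf.iSup_eigenspace_eq_top
  let v := eigenDecomp.collectedBasis fun μ => Module.finBasis K (f.eigenspace μ)
  let e := v.indexEquiv b₀
  refine ⟨v.reindex e, fun i => (e.symm i).1, fun i => ?_⟩
  rw [Module.Basis.reindex_apply]
  exact Module.End.mem_eigenspace_iff.1 (eigenDecomp.collectedBasis_mem _ (e.symm i))

theorem exists_eq_conjDiagonal {A : Matrix m m K} (hA : Module.End.IsSemisimple (toLin' A)) :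
    ∃ Q d, A = conjDiagonal Q d := by
  let P := Pi.basisFun K m
  obtain ⟨b, d, hb⟩ := exists_basis_apply_eq_smul hA P
  let Q : (Matrix m m K)ˣ :=
    ⟨P.toMatrix b, b.toMatrix P, P.toMatrix_mul_toMatrix_flip b, b.toMatrix_mul_toMatrix_flip P⟩
  refine ⟨Q, d, (Units.eq_mul_inv_iff_mul_eq _).2 ?_⟩
  ext i j
  rw [mul_diagonal, mul_comm]
  exact congrFun (hb j) i

theorem exists_isNilpotent_add_conjDiagonal (A : Matrix m m K) :
    ∃ N Q d, IsNilpotent N ∧ Commute N (conjDiagonal Q d) ∧ A = N + conjDiagonal Q d := by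
  obtain ⟨N, hN, S, hS, hN_nil, hS_ss, hNS⟩ :=
    Module.End.exists_isNilpotent_isSemisimple (f := toLin' A)
  obtain ⟨Q, d, hQ⟩ := exists_eq_conjDiagonal (A := LinearMap.toMatrix' S) (by simpa using hS_ss)
  have h_comm : Commute N S := Algebra.commute_of_mem_adjoin_singleton_of_commute hS
    (Algebra.commute_of_mem_adjoin_self hN).symm
  exact ⟨LinearMap.toMatrix' N, Q, d, hN_nil.map LinearMap.toMatrixAlgEquiv',
    hQ ▸ h_comm.map LinearMap.toMatrixAlgEquiv', by
      rw [← hQ, ← map_add, ← hNS, LinearMap.toMatrix'_toLin']⟩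

end ConjDiagonal

section Replicas

open Matrix NormedSpace

variable {m : Type*} [Fintype m] [DecidableEq m]

theorem exp_smul_eq_sum {N : Matrix m m ℂ} {K : ℕ} (hN : N ^ K = 0) (t : ℂ) :
    exp (t • N) = ∑ j ∈ Finset.range K, ((j.factorial : ℂ)⁻¹ * t ^ j) • N ^ j := by
  rw [exp_eq_tsum ℂ]
  change ∑' j : ℕ, (j.factorial : ℂ)⁻¹ • (t • N) ^ j = _
  rw [tsum_eq_sum (s := Finset.range K)]
  · simp only [smul_pow, smul_smul]
  · intro j hj
    rw [smul_pow, pow_eq_zero_of_le (by simpa using hj) hN, smul_zero, smul_zero]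

theorem exp_conjDiagonal (Q : (Matrix m m ℂ)ˣ) (d : m → ℂ) :
    exp (conjDiagonal Q d) = conjDiagonal Q (Complex.exp ∘ d) := by
  rw [conjDiagonal_apply, conjDiagonal_apply, Matrix.exp_units_conj, exp_diagonal, Pi.exp_def,
    Complex.exp_eq_exp_ℂ]
  rfl

/-- The one-parameter group `exp (t (N + Q diag(d) Q⁻¹))`, where `N ^ K = 0` and `N` commutes with
`Q diag(d) Q⁻¹`, as a matrix of exponential polynomials in `t`. -/
noncomputable def formalExp (N : Matrix m m ℂ) (K : ℕ) (Q : (Matrix m m ℂ)ˣ) (d : m → ℂ) :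
    Matrix m m ExpPoly :=
  (∑ j ∈ Finset.range K, AddMonoidAlgebra.single (0 : ℂ)
    (Polynomial.C (j.factorial : ℂ)⁻¹ * Polynomial.X ^ j) • (N ^ j).map (algebraMap ℂ ExpPoly)) *
  ((Q : Matrix m m ℂ).map (algebraMap ℂ ExpPoly) *
    diagonal (fun i => AddMonoidAlgebra.single (d i) 1) *
    (Q⁻¹ : (Matrix m m ℂ)ˣ).1.map (algebraMap ℂ ExpPoly))

theorem ExpPoly.mapMatrix_map_algebraMap (t : ℂ) (f : ℂ →+ ℂ) (M : Matrix m m ℂ) :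
    (ExpPoly.eval t f).mapMatrix (M.map (algebraMap ℂ ExpPoly)) = M := by
  ext i j
  exact ExpPoly.eval_algebraMap t f (M i j)

theorem ExpPoly.mapMatrix_formalExp (t : ℂ) (f : ℂ →+ ℂ) {N : Matrix m m ℂ} {K : ℕ}
    (hN : N ^ K = 0) (Q : (Matrix m m ℂ)ˣ) (d : m → ℂ) :
    (ExpPoly.eval t f).mapMatrix (formalExp N K Q d) =
      exp (t • N) * exp (conjDiagonal Q (f ∘ d)) := by
  rw [formalExp, map_mul, map_mul, map_mul, mapMatrix_map_algebraMap, mapMatrix_map_algebraMap,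
    exp_smul_eq_sum hN, exp_conjDiagonal, conjDiagonal_apply]
  congr 3
  · rw [map_sum]
    refine Finset.sum_congr rfl fun j _ => ?_
    ext a b
    rw [RingHom.mapMatrix_apply, map_apply, Matrix.smul_apply, smul_eq_mul, map_mul, map_apply,
      eval_algebraMap, eval_single]
    simp
  · rw [RingHom.mapMatrix_apply, diagonal_map (map_zero _)]
    simp [ExpPoly.eval_single, Function.comp_def]

theorem ExpPoly.eval_aeval (t : ℂ) (f : ℂ →+ ℂ) (M : Matrix m m ExpPoly)
    (p : MvPolynomial (m × m) ℂ) :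
    ExpPoly.eval t f (MvPolynomial.aeval (fun ij => M ij.1 ij.2) p) =
      MvPolynomial.eval (fun ij => (ExpPoly.eval t f).mapMatrix M ij.1 ij.2) p := by
  have h : (ExpPoly.eval t f).comp (algebraMap ℂ ExpPoly) = RingHom.id ℂ :=
    RingHom.ext (ExpPoly.eval_algebraMap t f)
  rw [MvPolynomial.aeval_def, MvPolynomial.hom_eval₂, h]
  rfl

theorem eval_exp_conjDiagonal_eq_zero {N : Matrix m m ℂ} {Q : (Matrix m m ℂ)ˣ} {d : m → ℂ}
    (hN : IsNilpotent N) (hNd : Commute N (conjDiagonal Q d)) {p : MvPolynomial (m × m) ℂ}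
    (hp : ∀ t : ℂ, MvPolynomial.eval
      (fun ij => exp (t • (N + conjDiagonal Q d)) ij.1 ij.2) p = 0) (f : ℂ →+ ℂ) :
    MvPolynomial.eval (fun ij => exp (conjDiagonal Q (f ∘ d)) ij.1 ij.2) p = 0 := by
  obtain ⟨K, hK⟩ := hN
  -- Once the equation holds for the formal exponential, the exponents may be moved by `f`.
  have h_formal : MvPolynomial.aeval (fun ij => formalExp N K Q d ij.1 ij.2) p = 0 := by
    refine ExpPoly.eq_zero_of_forall_eval_eq_zero _ fun t => ?_
    have hd : AddMonoidHom.mulLeft t ∘ d = t • d := rfl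
    rw [ExpPoly.eval_aeval, ExpPoly.mapMatrix_formalExp t _ hK, hd, map_smul, ← hp t, smul_add,
      exp_add_of_commute _ _ ((hNd.smul_left t).smul_right t)]
  rw [← map_zero (ExpPoly.eval 0 f), ← h_formal, ExpPoly.eval_aeval,
    ExpPoly.mapMatrix_formalExp 0 f hK, zero_smul, exp_zero, one_mul]

end Replicas

section OneParameterGenerators

open Matrix NormedSpace

variable {n : ℕ} {H : Subgroup (GL (Fin n) ℂ)}

/-- The matrices `X` generating a complex one-parameter subgroup `t ↦ exp (t X)` of `H`. For closed
`H`, these form the largest complex subspace of the Lie algebra of `H`. -/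
def IsOneParameterGenerator (H : Subgroup (GL (Fin n) ℂ)) (X : Matrix (Fin n) (Fin n) ℂ) : Prop :=
  ∀ t : ℂ, ∃ g ∈ H, (g : Matrix (Fin n) (Fin n) ℂ) = exp (t • X)

theorem eq_zero_of_forall_sum_mul_eq_zero {ι : Type*} [Fintype ι] {d : ι → ℂ}
    (hd : ∀ f : ℂ →ₗ[ℚ] ℚ, ∑ i, d i * (f (d i) : ℂ) = 0) : d = 0 := by
  funext i
  refine (Module.forall_dual_apply_eq_zero_iff ℚ (d i)).1 fun f => ?_
  have h_sq : ∑ i, f (d i) ^ 2 = 0 := by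
    rw [← map_zero f, ← hd f, map_sum]
    refine Finset.sum_congr rfl fun j _ => ?_
    rw [mul_comm, ← Rat.smul_def, map_smul, smul_eq_mul, sq]
  exact pow_eq_zero_iff two_ne_zero |>.1
    ((Finset.sum_eq_zero_iff_of_nonneg fun _ _ => sq_nonneg _).1 h_sq i (Finset.mem_univ i))

theorem IsZariskiClosed.isOneParameterGenerator_conjDiagonal (hH : IsZariskiClosed H)
    {N : Matrix (Fin n) (Fin n) ℂ} {Q : (Matrix (Fin n) (Fin n) ℂ)ˣ} {d : Fin n → ℂ}
    (hN : IsNilpotent N) (hNd : Commute N (conjDiagonal Q d))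
    (hX : IsOneParameterGenerator H (N + conjDiagonal Q d)) (f : ℂ →+ ℂ) :
    IsOneParameterGenerator H (conjDiagonal Q (f ∘ d)) := by
  obtain ⟨S, hS⟩ := hH
  intro s
  have hs : s • conjDiagonal Q (f ∘ d) =
      conjDiagonal Q ((AddMonoidHom.mulLeft s).comp f ∘ d) := by
    rw [← map_smul]
    rfl
  obtain ⟨u, hu⟩ := isUnit_exp (s • conjDiagonal Q (f ∘ d))
  refine ⟨u, (hS u).2 fun p hp => ?_, hu⟩
  rw [hu, hs]
  refine eval_exp_conjDiagonal_eq_zero hN hNd (fun t => ?_) _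
  obtain ⟨g, hg, hgt⟩ := hX t
  rw [← hgt]
  exact (hS g).1 hg p hp

theorem IsZariskiClosed.isNilpotent_of_trace_mul_eq_zero (hH : IsZariskiClosed H)
    {X : Matrix (Fin n) (Fin n) ℂ} (hX : IsOneParameterGenerator H X)
    (htr : ∀ Y, IsOneParameterGenerator H Y → trace (X * Y) = 0) : IsNilpotent X := by
  obtain ⟨N, Q, d, hN, hNd, rfl⟩ := exists_isNilpotent_add_conjDiagonal X
  suffices hd : d = 0 by simpa only [hd, map_zero, add_zero] using hN
  refine eq_zero_of_forall_sum_mul_eq_zero fun f => ?_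
  let f' : ℂ →+ ℂ := (Rat.castHom ℂ).toAddMonoidHom.comp f.toAddMonoidHom
  have h_nil : IsNilpotent (N * conjDiagonal Q (f' ∘ d)) :=
    (commute_conjDiagonal_comp hNd f').isNilpotent_mul_right hN
  have h := htr _ (hH.isOneParameterGenerator_conjDiagonal hN hNd hX f')
  rwa [add_mul, trace_add, (isNilpotent_trace_of_isNilpotent h_nil).eq_zero, zero_add, ← map_mul,
    trace_conjDiagonal] at h

end OneParameterGenerators

/-! ### The trace form of a reductive linear group -/

section NonUnitalAdjoin

theorem conj_mem_adjoin {R A : Type*} [CommSemiring R] [Semiring A] [Algebra R A] {s : Set A}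
    {g : Aˣ} (hg : ∀ x ∈ s, g * x * (g⁻¹ : Aˣ) ∈ s) {a : A}
    (ha : a ∈ NonUnitalAlgebra.adjoin R s) : g * a * (g⁻¹ : Aˣ) ∈ NonUnitalAlgebra.adjoin R s := by
  induction ha using NonUnitalAlgebra.adjoin_induction with
  | mem x hx => exact NonUnitalAlgebra.subset_adjoin R (hg x hx)
  | add x y _ _ hx hy => simpa only [mul_add, add_mul] using add_mem hx hy
  | zero => simp
  | mul x y _ _ hx hy => simpa only [mul_assoc, Units.inv_mul_cancel_left] using mul_mem hx hy
  | smul r x _ hx => simpa only [mul_smul_comm, smul_mul_assoc] using SMulMemClass.smul_mem r hx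

attribute [local instance 100] LieRing.ofAssociativeRing

theorem isNilpotent_of_mem_adjoin_lieSubalgebra {R M : Type*} [CommRing R] [AddCommGroup M]
    [Module R M] [IsNoetherian R M] {L : LieSubalgebra R (Module.End R M)}
    (hL : ∀ x ∈ L, IsNilpotent x) {a : Module.End R M}
    (ha : a ∈ NonUnitalAlgebra.adjoin R (L : Set (Module.End R M))) : IsNilpotent a := by
  have h_nil : LieModule.IsNilpotent L M := by
    rw [LieModule.isNilpotent_iff_forall' (R := R)]
    exact fun x => hL x x.2
  obtain ⟨k, hk⟩ := (LieModule.isNilpotent_iff R L M).1 h_nil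
  have h_lower (j : ℕ) : ∀ w ∈ LieModule.lowerCentralSeries R L M j,
      a w ∈ LieModule.lowerCentralSeries R L M (j + 1) := by
    induction ha using NonUnitalAlgebra.adjoin_induction with
    | mem x hx =>
      intro w hw
      rw [LieModule.lowerCentralSeries_succ]
      exact LieSubmodule.lie_mem_lie (x := (⟨x, hx⟩ : L)) (LieSubmodule.mem_top _) hw
    | add _ _ _ _ hx hy => exact fun w hw => add_mem (hx w hw) (hy w hw)
    | zero => exact fun w _ => zero_mem _
    | mul _ _ _ _ hx hy =>
      exact fun w hw => hx _ (LieModule.antitone_lowerCentralSeries R L M j.le_succ (hy w hw))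
    | smul r _ _ hx => exact fun w hw => Submodule.smul_mem _ r (hx w hw)
  have h_pow (j : ℕ) (w : M) : (a ^ j) w ∈ LieModule.lowerCentralSeries R L M j := by
    induction j with
    | zero => simp
    | succ j ih =>
      rw [pow_succ', Module.End.mul_apply]
      exact h_lower j _ ih
  exact ⟨k, LinearMap.ext fun w => by simpa [hk] using h_pow k w⟩

theorem isNilpotent_of_mem_adjoin_matrix {R m : Type*} [CommRing R] [IsNoetherianRing R]
    [Fintype m] [DecidableEq m] {L : LieSubalgebra R (Matrix m m R)}
    (hL : ∀ x ∈ L, IsNilpotent x) {a : Matrix m m R}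
    (ha : a ∈ NonUnitalAlgebra.adjoin R (L : Set (Matrix m m R))) : IsNilpotent a := by
  let e : Matrix m m R →ₐ[R] Module.End R (m → R) := Matrix.toLinAlgEquiv'.toAlgHom
  rw [← IsNilpotent.map_iff (f := e) Matrix.toLinAlgEquiv'.injective]
  refine isNilpotent_of_mem_adjoin_lieSubalgebra (L := L.map e.toLieHom) ?_ ?_
  · rintro _ ⟨x, hx, rfl⟩
    exact (hL x hx).map e
  · exact (NonUnitalAlgHom.map_adjoin R _ e (L : Set (Matrix m m R))).le ⟨a, ha, rfl⟩

variable {K A : Type*} [Field K] [Ring A] [Algebra K A] [FiniteDimensional K A]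

/-- The units in `1 + 𝔄`, for a non-unital subalgebra `𝔄` of a finite-dimensional algebra. -/
def oneAddSubgroup (𝔄 : NonUnitalSubalgebra K A) : Subgroup Aˣ where
  carrier := {u | (u : A) - 1 ∈ 𝔄}
  one_mem' := by simp
  mul_mem' {u v} hu hv := by
    have h : ((u * v : Aˣ) : A) - 1 = (u - 1) * (v - 1) + (u - 1) + (v - 1) := by
      rw [Units.val_mul]
      noncomm_ring
    exact Set.mem_ofPred_eq ▸ h ▸ add_mem (add_mem (mul_mem hu hv) hu) hv
  inv_mem' {u} hu := by
    -- Left multiplication by `u` is injective on `𝔄`, hence surjective.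
    have hu_mul (a : A) (ha : a ∈ 𝔄) : u * a ∈ 𝔄 := by
      simpa [sub_mul] using add_mem (mul_mem hu ha) ha
    let f : 𝔄.toSubmodule →ₗ[K] 𝔄.toSubmodule := (LinearMap.mulLeft K (u : A)).restrict hu_mul
    have hf : Function.Injective f := fun a b hab =>
      Subtype.ext ((Units.mul_right_inj u).1 (congrArg Subtype.val hab))
    obtain ⟨a, ha⟩ := LinearMap.injective_iff_surjective.1 hf ⟨_, neg_mem hu⟩
    have ha' : u * (a : A) = -(u - 1) := congrArg Subtype.val ha
    have h : ((u⁻¹ : Aˣ) : A) - 1 = a := by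
      rw [← Units.mul_right_inj u, ha', mul_sub, Units.mul_inv, mul_one, neg_sub]
    exact Set.mem_ofPred_eq ▸ h ▸ a.2

theorem mem_oneAddSubgroup {𝔄 : NonUnitalSubalgebra K A} {u : Aˣ} :
    u ∈ oneAddSubgroup 𝔄 ↔ (u : A) - 1 ∈ 𝔄 :=
  Iff.rfl

theorem conj_mem_oneAddSubgroup_adjoin {s : Set A} {g : Aˣ}
    (hg : ∀ x ∈ s, g * x * (g⁻¹ : Aˣ) ∈ s) {u : Aˣ}
    (hu : u ∈ oneAddSubgroup (NonUnitalAlgebra.adjoin K s)) :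
    g * u * g⁻¹ ∈ oneAddSubgroup (NonUnitalAlgebra.adjoin K s) := by
  have h := conj_mem_adjoin hg hu
  rwa [mul_sub, sub_mul, mul_one, Units.mul_inv] at h

theorem exp_sub_one_mem {m : Type*} [Fintype m] [DecidableEq m]
    {𝔄 : NonUnitalSubalgebra ℂ (Matrix m m ℂ)} {X : Matrix m m ℂ} (hX : X ∈ 𝔄)
    (hX_nil : IsNilpotent X) : NormedSpace.exp X - 1 ∈ 𝔄 := by
  obtain ⟨K, hK⟩ := hX_nil
  have h_pow (j : ℕ) : X ^ (j + 1) ∈ 𝔄 := by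
    induction j with
    | zero => simpa using hX
    | succ j ih => exact pow_succ X (j + 1) ▸ mul_mem ih hX
  have h_exp := exp_smul_eq_sum (pow_eq_zero_of_le K.le_succ hK) 1
  rw [one_smul, Finset.sum_range_succ'] at h_exp
  simp only [one_pow, mul_one, pow_zero, Nat.factorial_zero, Nat.cast_one, inv_one,
    one_smul] at h_exp
  rw [h_exp, add_sub_cancel_right]
  exact sum_mem fun j _ => SMulMemClass.smul_mem _ (h_pow j)

end NonUnitalAdjoin

section TraceRadical

open Matrix NormedSpace

variable {n : ℕ} {H : Subgroup (GL (Fin n) ℂ)}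

theorem IsZariskiClosed.inf_of_sub_one_mem_iff (hH : IsZariskiClosed H)
    {U : Subgroup (GL (Fin n) ℂ)} {W : Submodule ℂ (Matrix (Fin n) (Fin n) ℂ)}
    (hU : ∀ u : GL (Fin n) ℂ, u ∈ U ↔ (u : Matrix (Fin n) (Fin n) ℂ) - 1 ∈ W) :
    IsZariskiClosed (H ⊓ U) := by
  obtain ⟨S, hS⟩ := hH
  let P (φ : Module.Dual ℂ (Matrix (Fin n) (Fin n) ℂ)) : MvPolynomial (Fin n × Fin n) ℂ :=
    ∑ i, ∑ j, MvPolynomial.X (i, j) * MvPolynomial.C (φ (single i j 1)) - MvPolynomial.C (φ 1)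
  have hP (φ) (u : Matrix (Fin n) (Fin n) ℂ) :
      MvPolynomial.eval (fun ij => u ij.1 ij.2) (P φ) = φ (u - 1) := by
    have h_single (i j : Fin n) : φ (single i j (u i j)) = u i j * φ (single i j 1) := by
      rw [← smul_eq_mul, ← map_smul, smul_single, smul_eq_mul, mul_one]
    conv_rhs => rw [map_sub, matrix_eq_sum_single u]
    simp [P, h_single]
  refine ⟨S ∪ P '' W.dualAnnihilator, fun g => ?_⟩
  rw [Subgroup.mem_inf, hS, hU, ← Subspace.forall_mem_dualAnnihilator_apply_eq_zero_iff]
  simp only [Set.mem_union, or_imp, forall_and, Set.forall_mem_image, hP, SetLike.mem_coe]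

theorem IsOneParameterGenerator.conj {X : Matrix (Fin n) (Fin n) ℂ}
    (hX : IsOneParameterGenerator H X) {g : GL (Fin n) ℂ} (hg : g ∈ H) :
    IsOneParameterGenerator H (g * X * (g⁻¹ : GL (Fin n) ℂ)) := by
  intro t
  obtain ⟨u, hu, hut⟩ := hX t
  refine ⟨g * u * g⁻¹, mul_mem (mul_mem hg hu) (inv_mem hg), ?_⟩
  rw [Units.val_mul, Units.val_mul, hut, ← smul_mul_assoc, ← mul_smul_comm,
    Matrix.exp_units_conj]

theorem hasDerivAt_exp_smul_zero (𝕜 : Type*) {𝔸 : Type*} [RCLike 𝕜] [NormedRing 𝔸]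
    [NormedAlgebra 𝕜 𝔸] [CompleteSpace 𝔸] (X : 𝔸) : HasDerivAt (fun t : 𝕜 => exp (t • X)) X 0 := by
  simpa using hasDerivAt_exp_smul_const X (0 : 𝕜)

theorem eq_zero_of_forall_exp_smul_eq_one {𝕜 𝔸 : Type*} [RCLike 𝕜] [NormedRing 𝔸]
    [NormedAlgebra 𝕜 𝔸] [CompleteSpace 𝔸] {X : 𝔸} (hX : ∀ t : 𝕜, exp (t • X) = 1) : X = 0 := by
  have h := hasDerivAt_exp_smul_zero 𝕜 X
  rw [funext hX] at h
  exact h.unique (hasDerivAt_const _ _)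

theorem commutator_mem_of_conj_exp_mem {𝕜 𝔸 : Type*} [RCLike 𝕜] [NormedRing 𝔸]
    [NormedAlgebra 𝕜 𝔸] [CompleteSpace 𝔸] {L : Submodule 𝕜 𝔸} (hL : IsClosed (L : Set 𝔸)) {X Y : 𝔸}
    (h : ∀ t : 𝕜, exp (t • X) * Y * exp (t • -X) ∈ L) : X * Y - Y * X ∈ L := by
  have h_deriv :=
    ((hasDerivAt_exp_smul_zero 𝕜 X).mul_const Y).mul (hasDerivAt_exp_smul_zero 𝕜 (-X))
  have h_mem : X * Y - Y * X ∈ closure (L : Set 𝔸) := by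
    have h_image : (fun t : 𝕜 => exp (t • X) * Y * exp (t • -X)) '' Set.univ ⊆ L :=
      Set.image_subset_iff.2 fun t _ => h t
    have h_deriv_mem := range_deriv_subset_closure_span_image _ dense_univ ⟨0, h_deriv.deriv⟩
    simpa [sub_eq_add_neg] using closure_mono (Submodule.span_le.2 h_image) h_deriv_mem
  rwa [hL.closure_eq] at h_mem

/-- The radical of the trace form `(X, Y) ↦ tr (X Y)` on a space of matrices. -/
def traceRadical {m K : Type*} [Fintype m] [Field K] (V : Submodule K (Matrix m m K)) :
    Submodule K (Matrix m m K) where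
  carrier := {X | X ∈ V ∧ ∀ Y ∈ V, trace (X * Y) = 0}
  zero_mem' := ⟨zero_mem _, by simp⟩
  add_mem' hX hY := ⟨add_mem hX.1 hY.1, fun Z hZ => by
    rw [add_mul, trace_add, hX.2 Z hZ, hY.2 Z hZ, add_zero]⟩
  smul_mem' c _ hX := ⟨V.smul_mem c hX.1, fun Z hZ => by
    rw [smul_mul_assoc, trace_smul, hX.2 Z hZ, smul_zero]⟩

theorem conj_mem_traceRadical {m K : Type*} [Fintype m] [DecidableEq m] [Field K]
    {V : Submodule K (Matrix m m K)} {g : (Matrix m m K)ˣ}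
    (hg : ∀ X ∈ V, g * X * (g⁻¹ : (Matrix m m K)ˣ) ∈ V)
    (hg' : ∀ X ∈ V, (g⁻¹ : (Matrix m m K)ˣ) * X * g ∈ V) {X : Matrix m m K}
    (hX : X ∈ traceRadical V) : g * X * (g⁻¹ : (Matrix m m K)ˣ) ∈ traceRadical V := by
  refine ⟨hg X hX.1, fun Y hY => ?_⟩
  rw [← hX.2 _ (hg' Y hY), mul_assoc, mul_assoc, trace_mul_comm]
  simp only [mul_assoc]

variable {V : Submodule ℂ (Matrix (Fin n) (Fin n) ℂ)}

theorem conj_mem_traceRadical_of_mem (hV : ∀ X, X ∈ V ↔ IsOneParameterGenerator H X)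
    {g : GL (Fin n) ℂ} (hg : g ∈ H) {X : Matrix (Fin n) (Fin n) ℂ} (hX : X ∈ traceRadical V) :
    g * X * (g⁻¹ : GL (Fin n) ℂ) ∈ traceRadical V := by
  refine conj_mem_traceRadical (fun Y hY => (hV _).2 (((hV _).1 hY).conj hg)) (fun Y hY => ?_) hX
  simpa only [inv_inv] using (hV _).2 (((hV _).1 hY).conj (inv_mem hg))

attribute [local instance 100] LieRing.ofAssociativeRing
attribute [local instance] Matrix.linftyOpNormedRing Matrix.linftyOpNormedAlgebra

theorem lie_mem_traceRadical (hV : ∀ X, X ∈ V ↔ IsOneParameterGenerator H X)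
    {X Y : Matrix (Fin n) (Fin n) ℂ} (hX : X ∈ traceRadical V) (hY : Y ∈ traceRadical V) :
    ⁅X, Y⁆ ∈ traceRadical V := by
  rw [LieRing.of_associative_ring_bracket]
  refine commutator_mem_of_conj_exp_mem (Submodule.closed_of_finiteDimensional _) fun t => ?_
  obtain ⟨g, hg, hgt⟩ := (hV X).1 hX.1 t
  have h := conj_mem_traceRadical_of_mem hV hg hY
  rwa [coe_units_inv, hgt, ← Matrix.exp_neg, ← smul_neg] at h

theorem IsReductiveLinearGroup.traceRadical_eq_bot (hH : IsReductiveLinearGroup H)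
    (hV : ∀ X, X ∈ V ↔ IsOneParameterGenerator H X) : traceRadical V = ⊥ := by
  let L : LieSubalgebra ℂ (Matrix (Fin n) (Fin n) ℂ) :=
    { traceRadical V with lie_mem' := lie_mem_traceRadical hV }
  have hL_nil : ∀ X ∈ L, IsNilpotent X := fun X hX =>
    hH.isZariskiClosed.isNilpotent_of_trace_mul_eq_zero ((hV X).1 hX.1)
      fun Y hY => hX.2 Y ((hV Y).2 hY)
  let 𝔄 := NonUnitalAlgebra.adjoin ℂ (L : Set (Matrix (Fin n) (Fin n) ℂ))
  have hU : H ⊓ oneAddSubgroup 𝔄 = ⊥ :=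
    hH.eq_bot_of_unipotent _ inf_le_left
      (hH.isZariskiClosed.inf_of_sub_one_mem_iff (W := 𝔄.toSubmodule) fun _ => Iff.rfl)
      (fun g hg u hu => ⟨H.mul_mem (H.mul_mem hg hu.1) (H.inv_mem hg),
        conj_mem_oneAddSubgroup_adjoin (fun _ hX => conj_mem_traceRadical_of_mem hV hg hX) hu.2⟩)
      fun u hu => isNilpotent_of_mem_adjoin_matrix hL_nil hu.2
  refine (Submodule.eq_bot_iff _).2 fun X hX =>
    eq_zero_of_forall_exp_smul_eq_one (𝕜 := ℂ) fun t => ?_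
  obtain ⟨g, hg, hgt⟩ := (hV X).1 hX.1 t
  have htX : t • X ∈ L := L.smul_mem t hX
  have hgU : g ∈ H ⊓ oneAddSubgroup 𝔄 := by
    refine Subgroup.mem_inf.2 ⟨hg, mem_oneAddSubgroup.2 ?_⟩
    rw [hgt]
    exact exp_sub_one_mem (NonUnitalAlgebra.subset_adjoin ℂ htX) (hL_nil _ htX)
  rw [hU, Subgroup.mem_bot] at hgU
  exact hgt.symm.trans (congrArg Units.val hgU)

end TraceRadical

/-! ### The differential of a matrix representation -/

section ExpLimit

open Filter Topology NormedSpace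

variable {𝔸 : Type*} [NormedRing 𝔸]

theorem norm_pow_le_exp (a : 𝔸) (m : ℕ) : ‖a ^ m‖ ≤ ‖(1 : 𝔸)‖ * Real.exp (m * ‖a - 1‖) := by
  induction m with
  | zero => simp
  | succ m ih =>
    have h_split : a ^ (m + 1) = a ^ m + a ^ m * (a - 1) := by noncomm_ring
    calc ‖a ^ (m + 1)‖ ≤ ‖a ^ m‖ + ‖a ^ m‖ * ‖a - 1‖ :=
          h_split ▸ (norm_add_le _ _).trans (add_le_add_right (norm_mul_le _ _) _)
      _ = ‖a ^ m‖ * (‖a - 1‖ + 1) := by ring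
      _ ≤ ‖(1 : 𝔸)‖ * Real.exp (m * ‖a - 1‖) * Real.exp ‖a - 1‖ := by
          gcongr
          exact Real.add_one_le_exp _
      _ = ‖(1 : 𝔸)‖ * Real.exp ((m + 1 : ℕ) * ‖a - 1‖) := by
          rw [mul_assoc, ← Real.exp_add, Nat.cast_add_one, add_one_mul]

theorem norm_pow_sub_pow_le {a b : 𝔸} {m : ℕ} {C : ℝ} (ha : ∀ i ≤ m, ‖a ^ i‖ ≤ C)
    (hb : ∀ i ≤ m, ‖b ^ i‖ ≤ C) : ‖a ^ m - b ^ m‖ ≤ m * (C * ‖a - b‖ * C) := by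
  have hC : 0 ≤ C := (norm_nonneg _).trans (ha 0 m.zero_le)
  have h_telescope : a ^ m - b ^ m = ∑ i ∈ Finset.range m, a ^ i * (a - b) * b ^ (m - (i + 1)) := by
    have h := Finset.sum_range_sub (fun i => a ^ i * b ^ (m - i)) m
    simp only [Nat.sub_self, pow_zero, mul_one, one_mul, Nat.sub_zero] at h
    rw [← h]
    refine Finset.sum_congr rfl fun i hi => ?_
    have hi' : m - i = m - (i + 1) + 1 := by grind
    rw [hi', pow_succ a i, pow_succ' b]
    noncomm_ring
  rw [h_telescope, ← nsmul_eq_mul, ← Finset.card_range m, ← Finset.sum_const, Finset.card_range]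
  refine norm_sum_le_of_le _ fun i hi => ?_
  refine (norm_mul_le _ _).trans (mul_le_mul ?_ (hb _ (Nat.sub_le _ _)) (norm_nonneg _) ?_)
  · exact (norm_mul_le _ _).trans (by gcongr; exact ha i (Finset.mem_range.1 hi).le)
  · positivity

theorem norm_pow_sub_pow_le_of_mul_norm_sub_one_le {a b : 𝔸} {m : ℕ} {C : ℝ}
    (ha : m * ‖a - 1‖ ≤ C) (hb : m * ‖b - 1‖ ≤ C) :
    ‖a ^ m - b ^ m‖ ≤ (‖(1 : 𝔸)‖ * Real.exp C) ^ 2 * (m * ‖a - b‖) := by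
  have h_pow {c : 𝔸} (hc : m * ‖c - 1‖ ≤ C) (i : ℕ) (hi : i ≤ m) :
      ‖c ^ i‖ ≤ ‖(1 : 𝔸)‖ * Real.exp C := by
    refine (norm_pow_le_exp c i).trans ?_
    gcongr
    exact le_trans (by gcongr) hc
  exact (norm_pow_sub_pow_le (h_pow ha) (h_pow hb)).trans_eq (by ring)

variable {𝕜 : Type*} [RCLike 𝕜] [NormedAlgebra 𝕜 𝔸] [CompleteSpace 𝔸]

theorem tendsto_natCast_smul_exp_sub_one (X : 𝔸) :
    Tendsto (fun k : ℕ => (k : 𝕜) • (exp ((k : 𝕜)⁻¹ • X) - 1)) atTop (𝓝 X) := by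
  have h_inv : Tendsto (fun k : ℕ => (k : 𝕜)⁻¹) atTop (𝓝[≠] 0) := by
    refine tendsto_nhdsWithin_iff.2 ⟨tendsto_inv_atTop_nhds_zero_nat, ?_⟩
    filter_upwards [eventually_ne_atTop 0] with k hk
    exact inv_ne_zero (Nat.cast_ne_zero.2 hk)
  have h_slope := hasDerivAt_iff_tendsto_slope_zero.1 (hasDerivAt_exp_smul_zero 𝕜 X)
  simpa [Function.comp_def] using h_slope.comp h_inv

theorem tendsto_exp_natCast_inv_smul (X : 𝔸) :
    Tendsto (fun k : ℕ => exp ((k : 𝕜)⁻¹ • X)) atTop (𝓝 1) := by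
  have h_exp : Tendsto (fun t : 𝕜 => exp (t • X)) (𝓝 0) (𝓝 1) := by
    simpa using (hasDerivAt_exp_smul_zero 𝕜 X).continuousAt.tendsto
  exact h_exp.comp tendsto_inv_atTop_nhds_zero_nat

theorem tendsto_pow_exp_of_tendsto_natCast_smul_sub_one {a : ℕ → 𝔸} {X : 𝔸}
    (ha : Tendsto (fun k : ℕ => (k : 𝕜) • (a k - 1)) atTop (𝓝 X)) :
    Tendsto (fun k => a k ^ k) atTop (𝓝 (exp X)) := by
  let b (k : ℕ) : 𝔸 := exp ((k : 𝕜)⁻¹ • X)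
  have hb : Tendsto (fun k : ℕ => (k : 𝕜) • (b k - 1)) atTop (𝓝 X) :=
    tendsto_natCast_smul_exp_sub_one X
  have hb_pow {k : ℕ} (hk : k ≠ 0) : b k ^ k = exp X := by
    let _ : NormedAlgebra ℚ 𝔸 := NormedAlgebra.restrictScalars ℚ 𝕜 𝔸
    rw [← exp_nsmul, ← Nat.cast_smul_eq_nsmul 𝕜, smul_inv_smul₀ (Nat.cast_ne_zero.2 hk)]
  have h_bound {c : ℕ → 𝔸} (hc : Tendsto (fun k : ℕ => (k : 𝕜) • (c k - 1)) atTop (𝓝 X)) :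
      ∀ᶠ k : ℕ in atTop, k * ‖c k - 1‖ ≤ ‖X‖ + 1 := by
    simpa only [norm_smul, RCLike.norm_natCast] using
      hc.norm.eventually_le_const (lt_add_one ‖X‖)
  have h_diff : Tendsto (fun k : ℕ => (‖(1 : 𝔸)‖ * Real.exp (‖X‖ + 1)) ^ 2 * (k * ‖a k - b k‖))
      atTop (𝓝 0) := by
    simpa [← smul_sub, norm_smul] using
      (ha.sub hb).norm.const_mul ((‖(1 : 𝔸)‖ * Real.exp (‖X‖ + 1)) ^ 2)
  refine tendsto_iff_norm_sub_tendsto_zero.2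
    (squeeze_zero' (Eventually.of_forall fun _ => norm_nonneg _) ?_ h_diff)
  filter_upwards [h_bound ha, h_bound hb, eventually_ne_atTop 0] with k hak hbk hk
  exact hb_pow hk ▸ norm_pow_sub_pow_le_of_mul_norm_sub_one_le hak hbk

end ExpLimit

section Differential

open Filter Topology

variable {𝕜 E F : Type*} [NontriviallyNormedField 𝕜] [CompleteSpace 𝕜]
  [NormedAddCommGroup E] [NormedSpace 𝕜 E] [FiniteDimensional 𝕜 E]
  [NormedAddCommGroup F] [NormedSpace 𝕜 F] {f : E → F} {D : E →L[𝕜] F} {x : E}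

theorem mem_range_fderiv_of_tendsto (hf : HasFDerivAt f D x) (hD : Function.Injective D)
    {α : Type*} {l : Filter α} [l.NeBot] {e : α → E} {c : α → 𝕜} {y : F} (he : Tendsto e l (𝓝 x))
    (hy : Tendsto (fun k => c k • (f (e k) - f x)) l (𝓝 y)) : y ∈ Set.range D := by
  have hD' : IsClosedEmbedding D :=
    LinearMap.isClosedEmbedding_of_injective (f := D.toLinearMap) (LinearMap.ker_eq_bot.2 hD)
  have h_rem : (fun k => f (e k) - f x - D (e k - x)) =o[l] fun k => f (e k) - f x :=
    (hf.isLittleO.trans_isTheta (hf.isTheta_sub hD'.isInducing).symm).comp_tendsto he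
  have h_rem_zero : Tendsto (fun k => c k • (f (e k) - f x - D (e k - x))) l (𝓝 0) :=
    (Asymptotics.isLittleO_one_iff ℝ).1 <|
      ((Asymptotics.isBigO_refl c l).smul_isLittleO h_rem).trans_isBigO (hy.isBigO_one ℝ)
  have h_lim : Tendsto (fun k => D (c k • (e k - x))) l (𝓝 y) := by
    simpa only [← smul_sub, sub_sub_cancel, ← map_smul, sub_zero] using hy.sub h_rem_zero
  exact hD'.isClosed_range.mem_of_tendsto h_lim (Eventually.of_forall fun k => ⟨_, rfl⟩)

end Differential

noncomputable section MatrixDifferential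

open Filter Topology Matrix

variable {E : Type*} [NormedAddCommGroup E] [NormedSpace ℂ E]
  {G : Type*} [TopologicalSpace G] [ChartedSpace E G] [Group G] {n : ℕ} {ρ : G →* GL (Fin n) ℂ}

/-- The differential at the identity of a matrix representation `ρ` of a complex Lie group. The
matrix-valued function `ρ` is differentiated as a function with values in `Fin n → Fin n → ℂ`, since
`Matrix` carries no norm. -/
def matrixDifferential (ρ : G →* GL (Fin n) ℂ) :
    GroupLieAlgebra 𝓘(ℂ, E) G →L[ℂ] Matrix (Fin n) (Fin n) ℂ :=
  mfderiv 𝓘(ℂ, E) 𝓘(ℂ, Fin n → Fin n → ℂ) (fun g i j => (ρ g : Matrix (Fin n) (Fin n) ℂ) i j) 1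

variable (hρ : ∀ i j, ContMDiff 𝓘(ℂ, E) 𝓘(ℂ, ℂ) ω
  fun g : G => (ρ g : Matrix (Fin n) (Fin n) ℂ) i j)

include hρ

theorem hasMFDerivAt_matrixDifferential :
    HasMFDerivAt 𝓘(ℂ, E) 𝓘(ℂ, Fin n → Fin n → ℂ)
      (fun g i j => (ρ g : Matrix (Fin n) (Fin n) ℂ) i j) 1 (matrixDifferential ρ) :=
  (ContMDiff.mdifferentiable (n := ω)
    (contMDiff_pi_space.2 fun i => contMDiff_pi_space.2 fun j => hρ i j) (by simp) 1).hasMFDerivAt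

theorem matrixDifferential_apply_apply (v : GroupLieAlgebra 𝓘(ℂ, E) G) (i j : Fin n) :
    matrixDifferential ρ v i j =
      mfderiv 𝓘(ℂ, E) 𝓘(ℂ, ℂ) (fun g => (ρ g : Matrix (Fin n) (Fin n) ℂ) i j) 1 v := by
  let π : (Fin n → Fin n → ℂ) →L[ℂ] ℂ :=
    (ContinuousLinearMap.proj (φ := fun _ => ℂ) j).comp
      (ContinuousLinearMap.proj (φ := fun _ => Fin n → ℂ) i)
  have h := π.hasMFDerivAt.comp (1 : G) (hasMFDerivAt_matrixDifferential hρ)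
  exact (DFunLike.congr_fun h.mfderiv v).symm

theorem hasFDerivAt_chart_symm :
    HasFDerivAt (fun e : E => (ρ ((chartAt E (1 : G)).symm e) : Matrix (Fin n) (Fin n) ℂ))
      (matrixDifferential ρ : E →L[ℂ] Matrix (Fin n) (Fin n) ℂ) (chartAt E (1 : G) 1) := by
  have h := (hasMFDerivAt_matrixDifferential hρ).2
  rw [ModelWithCorners.range_eq_univ] at h
  exact hasFDerivWithinAt_univ.1 h

theorem matrixDifferential_adLinear [LieGroup 𝓘(ℂ, E) ω G] (g : G)
    (v : GroupLieAlgebra 𝓘(ℂ, E) G) :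
    matrixDifferential ρ (adLinear E G g v) =
      ρ g * matrixDifferential ρ v * ((ρ g)⁻¹ : GL (Fin n) ℂ) := by
  let f (x : G) (i j : Fin n) : ℂ := (ρ x : Matrix (Fin n) (Fin n) ℂ) i j
  let c : Matrix (Fin n) (Fin n) ℂ →ₗ[ℂ] Matrix (Fin n) (Fin n) ℂ :=
    LinearMap.mulLeftRight ℂ ((ρ g : Matrix (Fin n) (Fin n) ℂ), ((ρ g)⁻¹ : GL (Fin n) ℂ).1)
  let L : (Fin n → Fin n → ℂ) →L[ℂ] (Fin n → Fin n → ℂ) :=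
    LinearMap.toContinuousLinearMap (E := Fin n → Fin n → ℂ) (F' := Fin n → Fin n → ℂ) c
  have h_conj : MDifferentiableAt 𝓘(ℂ, E) 𝓘(ℂ, E) (fun x : G => g * x * g⁻¹) 1 :=
    ((contMDiff_mul_right (n := ω) (a := g⁻¹)).comp
      (contMDiff_mul_left (a := g))).mdifferentiableAt (by simp)
  have h_comp : f ∘ (fun x => g * x * g⁻¹) = L ∘ f := by
    ext x i j
    change (ρ (g * x * g⁻¹) : Matrix (Fin n) (Fin n) ℂ) i j =
      ((ρ g : Matrix (Fin n) (Fin n) ℂ) * ρ x * ((ρ g)⁻¹ : GL (Fin n) ℂ)) i j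
    rw [map_mul, map_mul, map_inv, Units.val_mul, Units.val_mul]
  have hf (y : G) (hy : y = 1) : HasMFDerivAt 𝓘(ℂ, E) 𝓘(ℂ, Fin n → Fin n → ℂ) f y
      (matrixDifferential ρ : E →L[ℂ] Fin n → Fin n → ℂ) :=
    hy ▸ hasMFDerivAt_matrixDifferential hρ
  have h_left := (hf (g * 1 * g⁻¹) (by simp)).comp (1 : G) h_conj.hasMFDerivAt
  have h_right := L.hasMFDerivAt.comp (1 : G) (hf 1 rfl)
  rw [h_comp] at h_left
  exact DFunLike.congr_fun (hasMFDerivAt_unique h_left h_right) v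

end MatrixDifferential

section RangeOfDifferential

open Filter Topology Matrix NormedSpace

variable {E : Type*} [NormedAddCommGroup E] [NormedSpace ℂ E]
  {G : Type*} [TopologicalSpace G] [ChartedSpace E G] [Group G] {n : ℕ}

theorem IsZariskiClosed.isClosed {H : Subgroup (GL (Fin n) ℂ)} (hH : IsZariskiClosed H) :
    IsClosed (H : Set (GL (Fin n) ℂ)) := by
  obtain ⟨S, hS⟩ := hH
  have hH_eq : (H : Set (GL (Fin n) ℂ)) = ⋂ p ∈ S, {g : GL (Fin n) ℂ |
      MvPolynomial.eval (fun ij => (g : Matrix (Fin n) (Fin n) ℂ) ij.1 ij.2) p = 0} := by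
    ext g
    simp only [SetLike.mem_coe, hS, Set.mem_iInter, Set.mem_ofPred_eq]
  rw [hH_eq]
  refine isClosed_biInter fun p _ => isClosed_eq ?_ continuous_const
  exact (MvPolynomial.continuous_eval p).comp
    (continuous_pi fun ij => Units.continuous_val.matrix_elem ij.1 ij.2)

attribute [local instance] Matrix.linftyOpNormedRing Matrix.linftyOpNormedAlgebra

theorem tendsto_units_iff {α : Type*} {l : Filter α} {a : α → GL (Fin n) ℂ} {u : GL (Fin n) ℂ} :
    Tendsto a l (𝓝 u) ↔
      Tendsto (fun k => (a k : Matrix (Fin n) (Fin n) ℂ)) l (𝓝 (u : Matrix (Fin n) (Fin n) ℂ)) :=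
  (Units.isOpenEmbedding_val (R := Matrix (Fin n) (Fin n) ℂ)).tendsto_nhds_iff

variable {ρ : G →* GL (Fin n) ℂ}
  (hρ : ∀ i j, ContMDiff 𝓘(ℂ, E) 𝓘(ℂ, ℂ) ω fun g : G => (ρ g : Matrix (Fin n) (Fin n) ℂ) i j)

include hρ

theorem exists_mem_range_eq_exp_matrixDifferential (hρ_closed : IsZariskiClosed ρ.range)
    (v : GroupLieAlgebra 𝓘(ℂ, E) G) :
    ∃ g ∈ ρ.range, (g : Matrix (Fin n) (Fin n) ℂ) = exp (matrixDifferential ρ v) := by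
  let D : E →L[ℂ] Matrix (Fin n) (Fin n) ℂ := matrixDifferential ρ
  let w : E := v
  let y (k : ℕ) : G := (chartAt E (1 : G)).symm (chartAt E (1 : G) 1 + (k : ℂ)⁻¹ • w)
  have h_lim : Tendsto (fun k : ℕ => (k : ℂ) • ((ρ (y k) : Matrix (Fin n) (Fin n) ℂ) - 1)) atTop
      (𝓝 (matrixDifferential ρ v)) := by
    have h_natCast : Tendsto (fun k : ℕ => ‖(k : ℂ)‖) atTop atTop := by
      simpa only [Complex.norm_natCast] using tendsto_natCast_atTop_atTop
    have h := HasFDerivAt.lim (f' := D) (hasFDerivAt_chart_symm hρ) w h_natCast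
    rwa [(chartAt E (1 : G)).left_inv (mem_chart_source E 1), map_one, Units.val_one] at h
  have h_pow : Tendsto (fun k => (ρ (y k) : Matrix (Fin n) (Fin n) ℂ) ^ k) atTop
      (𝓝 (exp (matrixDifferential ρ v))) :=
    tendsto_pow_exp_of_tendsto_natCast_smul_sub_one h_lim
  obtain ⟨u, hu⟩ := Matrix.isUnit_exp (matrixDifferential ρ v)
  have h_units : Tendsto (fun k => ρ (y k) ^ k) atTop (𝓝 u) := by
    rw [tendsto_units_iff, hu]
    exact h_pow
  exact ⟨u, hρ_closed.isClosed.mem_of_tendsto h_units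
    (Eventually.of_forall fun k => ρ.range.pow_mem ⟨y k, rfl⟩ k), hu⟩

theorem isOneParameterGenerator_matrixDifferential (hρ_closed : IsZariskiClosed ρ.range)
    (v : GroupLieAlgebra 𝓘(ℂ, E) G) :
    IsOneParameterGenerator ρ.range (matrixDifferential ρ v) := by
  intro t
  rw [← map_smul]
  exact exists_mem_range_eq_exp_matrixDifferential hρ hρ_closed (t • v)

theorem mem_range_matrixDifferential [FiniteDimensional ℂ E] (hρ_emb : IsEmbedding ρ)
    (hρ_inj : Function.Injective (matrixDifferential (E := E) ρ)) {X : Matrix (Fin n) (Fin n) ℂ}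
    (hX : IsOneParameterGenerator ρ.range X) : X ∈ Set.range (matrixDifferential (E := E) ρ) := by
  have h_preimage (k : ℕ) :
      ∃ y : G, (ρ y : Matrix (Fin n) (Fin n) ℂ) = exp ((k : ℂ)⁻¹ • X) := by
    obtain ⟨_, ⟨y, rfl⟩, h⟩ := hX (k : ℂ)⁻¹
    exact ⟨y, h⟩
  choose y hy using h_preimage
  have hy_lim : Tendsto y atTop (𝓝 1) := by
    have h_exp : Tendsto (fun k : ℕ => exp ((k : ℂ)⁻¹ • X)) atTop (𝓝 1) :=
      tendsto_exp_natCast_inv_smul X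
    rw [hρ_emb.tendsto_nhds_iff, map_one, tendsto_units_iff]
    exact h_exp.congr fun k => (hy k).symm
  let c := chartAt E (1 : G)
  have hc : (1 : G) ∈ c.source := mem_chart_source E 1
  have h_chart : ∀ᶠ k in atTop, c.symm (c (y k)) = y k :=
    (hy_lim.eventually (c.open_source.mem_nhds hc)).mono fun k => c.left_inv
  refine mem_range_fderiv_of_tendsto (F := Fin n → Fin n → ℂ) (c := fun k : ℕ => (k : ℂ))
    (hasFDerivAt_chart_symm hρ) hρ_inj ((c.continuousAt hc).tendsto.comp hy_lim) ?_
  have h_lim : Tendsto (fun k : ℕ => (k : ℂ) • (exp ((k : ℂ)⁻¹ • X) - 1)) atTop (𝓝 X) :=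
    tendsto_natCast_smul_exp_sub_one X
  refine h_lim.congr' (h_chart.mono fun k hk => ?_)
  change _ = (k : ℂ) • ((ρ (c.symm (c (y k))) : Matrix (Fin n) (Fin n) ℂ) - ρ (c.symm (c 1)))
  rw [hk, hy, c.left_inv hc, map_one, Units.val_one]

end RangeOfDifferential

/-! ### Duality -/

section Duality

open LinearMap (BilinForm)

universe u

variable {k V Γ : Type u} [Field k] [AddCommGroup V] [Module k V] [Group Γ]

theorem nonempty_quotient_equiv_orthogonal [FiniteDimensional k V] {B : BilinForm k V}
    (hB : B.Nondegenerate) (W : Submodule k V) : Nonempty ((V ⧸ W) ≃ₗ[k] B.orthogonal W) :=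
  ⟨LinearEquiv.ofFinrankEq _ _ (by
    rw [BilinForm.finrank_orthogonal hB, W.finrank_quotient])⟩

theorem orthogonal_iSup_range_add_one {B : BilinForm k V} (hB : B.Nondegenerate)
    {ρ : Representation k Γ V} (hρ : ∀ g v w, B (ρ g v) (ρ g w) = B v w) {ι : Type*} (x : ι → Γ) :
    B.orthogonal (⨆ i, LinearMap.range (ρ (x i) + 1)) = ⨅ i, LinearMap.ker (ρ (x i) + 1) := by
  have h_adjoint (i : ι) (v w : V) :
      B (ρ (x i) v) ((ρ (x i) + 1) w) = B ((ρ (x i) + 1) v) w := by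
    simp only [LinearMap.add_apply, Module.End.one_apply, map_add, hρ, add_comm]
  ext w
  simp only [Submodule.mem_iInf, LinearMap.mem_ker]
  constructor
  · intro hw i
    refine hB.2 _ fun v => ?_
    rw [← ρ.self_inv_apply (x i) v, h_adjoint]
    exact hw _ (Submodule.mem_iSup_of_mem i ⟨_, rfl⟩)
  · intro hw
    have h_le : ⨆ i, LinearMap.range (ρ (x i) + 1) ≤ LinearMap.ker (LinearMap.flip B w) := by
      refine iSup_le fun i => ?_
      rintro _ ⟨v, rfl⟩
      rw [LinearMap.mem_ker, LinearMap.flip_apply, ← h_adjoint, hw i, map_zero]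
    exact fun v hv => h_le hv

theorem IsNonorientableSurfaceGroup.nonempty_H2_equiv_iInf_ker [FiniteDimensional k V] {h : ℕ}
    {x : Fin h → Γ} (hx : IsNonorientableSurfaceGroup x) (hh : 2 ≤ h) {B : BilinForm k V}
    (hB : B.Nondegenerate)
    {ρ : Representation k Γ V} (hρ : ∀ g v w, B (ρ g v) (ρ g w) = B v w) :
    Nonempty (groupCohomology (Rep.of ρ) 2 ≃ₗ[k]
      (⨅ i, LinearMap.ker (ρ (x i) + 1) : Submodule k V)) := by
  obtain ⟨e⟩ := hx.nonempty_H2_equiv_quotient hh ρ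
  obtain ⟨e'⟩ := nonempty_quotient_equiv_orthogonal hB (⨆ i, LinearMap.range (ρ (x i) + 1))
  exact ⟨e ≪≫ₗ e' ≪≫ₗ LinearEquiv.ofEq _ _ (orthogonal_iSup_range_add_one hB hρ x)⟩

end Duality

section Reductive

open Matrix
open LinearMap (BilinForm)

variable {E : Type*} [NormedAddCommGroup E] [NormedSpace ℂ E] [FiniteDimensional ℂ E]
  {G : Type*} [TopologicalSpace G] [ChartedSpace E G] [Group G]

theorem IsReductiveLinearGroup.eq_zero_of_trace_matrixDifferential_mul_eq_zero {n : ℕ}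
    {ρ : G →* GL (Fin n) ℂ} (hH : IsReductiveLinearGroup ρ.range)
    (hρ : ∀ i j, ContMDiff 𝓘(ℂ, E) 𝓘(ℂ, ℂ) ω fun g : G => (ρ g : Matrix (Fin n) (Fin n) ℂ) i j)
    (hρ_emb : Topology.IsEmbedding ρ)
    (hρ_inj : Function.Injective (matrixDifferential (E := E) ρ)) {v : GroupLieAlgebra 𝓘(ℂ, E) G}
    (hv : ∀ w : GroupLieAlgebra 𝓘(ℂ, E) G,
      trace (matrixDifferential ρ v * matrixDifferential ρ w) = 0) : v = 0 := by
  let V := LinearMap.range (matrixDifferential (E := E) ρ).toLinearMap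
  have hV (X : Matrix (Fin n) (Fin n) ℂ) : X ∈ V ↔ IsOneParameterGenerator ρ.range X := by
    refine ⟨?_, mem_range_matrixDifferential hρ hρ_emb hρ_inj⟩
    rintro ⟨w, rfl⟩
    exact isOneParameterGenerator_matrixDifferential hρ hH.isZariskiClosed w
  have h_mem : matrixDifferential ρ v ∈ traceRadical V :=
    ⟨⟨v, rfl⟩, Set.forall_mem_range.2 hv⟩
  rw [hH.traceRadical_eq_bot hV, Submodule.mem_bot] at h_mem
  exact (map_eq_zero_iff _ hρ_inj).1 h_mem

theorem IsComplexReductive.exists_nondegenerate_invariant_form [LieGroup 𝓘(ℂ, E) ω G]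
    (hG : IsComplexReductive E G) :
    ∃ B : BilinForm ℂ (GroupLieAlgebra 𝓘(ℂ, E) G), B.Nondegenerate ∧
      ∀ g v w, B (adjointRep E G g v) (adjointRep E G g w) = B v w := by
  obtain ⟨n, ρ, hρ_emb, hρ, hρ_imm, hH⟩ := hG
  let δ := matrixDifferential (E := E) ρ
  have hδ_inj : Function.Injective δ := by
    refine (injective_iff_map_eq_zero δ).2 fun v hv => hρ_imm v fun i j => ?_
    rw [← matrixDifferential_apply_apply hρ]
    exact congrFun₂ hv i j
  let B : BilinForm ℂ (GroupLieAlgebra 𝓘(ℂ, E) G) :=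
    ((LinearMap.mul ℂ (Matrix (Fin n) (Fin n) ℂ)).compr₂
      (traceLinearMap (Fin n) ℂ ℂ)).compl₁₂ δ.toLinearMap δ.toLinearMap
  have hB_symm : B.IsSymm := ⟨fun v w => trace_mul_comm (δ v) (δ w)⟩
  refine ⟨B, hB_symm.isRefl.nondegenerate_iff_separatingLeft.2 fun v hv =>
    hH.eq_zero_of_trace_matrixDifferential_mul_eq_zero hρ hρ_emb hδ_inj hv, fun g v w => ?_⟩
  change trace (δ (adLinear E G g v) * δ (adLinear E G g w)) = trace (δ v * δ w)
  rw [matrixDifferential_adLinear hρ, matrixDifferential_adLinear hρ,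
    ← trace_units_conj (ρ g) (δ v * δ w)]
  simp only [δ, mul_assoc, Units.inv_mul_cancel_left]

end Reductive

theorem proposition3p7
    {E : Type} [NormedAddCommGroup E] [NormedSpace ℂ E] [FiniteDimensional ℂ E]
    {G : Type*} [TopologicalSpace G] [ChartedSpace E G] [Group G] [LieGroup 𝓘(ℂ, E) ω G]
    (hG : IsComplexReductive E G)
    {Γ : Type} [Group Γ] {h : ℕ} (hh : 1 ≤ h) (x : Fin h → Γ)
    (hx : IsNonorientableSurfaceGroup x) (φ : Γ →* G) :
    -- `A` is the Lie algebra of `G` on which `Γ` acts through `Ad ∘ φ`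
    let A : Rep ℂ Γ := Rep.of ((adjointRep E G).comp φ)
    (A.ρ.invariants = ⨅ i, LinearMap.ker (adjointRep E G (φ (x i)) - 1) ∧
      Nonempty (groupCohomology A 0 ≃ₗ[ℂ]
        ↥(⨅ i, LinearMap.ker (adjointRep E G (φ (x i)) - 1)))) ∧
    (2 ≤ h →
      Nonempty (groupCohomology A 2 ≃ₗ[ℂ]
        ↥(⨅ i, LinearMap.ker (adjointRep E G (φ (x i)) + 1)))) := by
  intro A
  have h_inv : A.ρ.invariants = ⨅ i, LinearMap.ker (adjointRep E G (φ (x i)) - 1) :=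
    hx.invariants_eq ((adjointRep E G).comp φ)
  refine ⟨⟨h_inv, ⟨(groupCohomology.H0Iso A).toLinearEquiv ≪≫ₗ LinearEquiv.ofEq _ _ h_inv⟩⟩,
    fun h2 => ?_⟩
  obtain ⟨B, hB, hB_inv⟩ := hG.exists_nondegenerate_invariant_form
  have : FiniteDimensional ℂ (GroupLieAlgebra 𝓘(ℂ, E) G) :=
    inferInstanceAs (FiniteDimensional ℂ E)
  exact hx.nonempty_H2_equiv_iInf_ker h2 hB (ρ := (adjointRep E G).comp φ) fun g => hB_inv (φ g)
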